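/- Let $D,E\in\mathbb N$ and let $n^a\ge 1$ for each environment $a\in[E]$. In environment $a$ one has random covariates $X^a=(X^a_{d,i})_{d\in[D],\,i\in[n^a]}$ and targets $Y^a=(Y^a_i)_{i\in[n^a]}$, all with finite variance and all defined on one probability space. Fix $S^*\subseteq[D]$, a zero-mean distribution $F^*$ on $\mathbb R$, and two environments $e\ne v$. *Invariant linear model.* There are $\beta^a\in\mathbb R^D$ with $\beta^a_d=0$ for $d\notin S^*$ such that, for all $a\in[E]$ and $i\in[n^a]$, $Y^a_i=\sum_d X^a_{d,i}\beta^a_d+\varepsilon^a_i$ with $\varepsilon^a_i\sim F^*$, with $\varepsilon^a_i$ independent of $\varepsilon^a_j$ for $i\neq j$, and with $\varepsilon^a_i$ independent of $(X^a_{d,i})_{d\in S^*}$. *Structural equations in environment $e$.* There is an acyclic graph on $[D]\cup\{y\}$, where $X^e_y:=Y^e$, in which every $d\in S^*$ is a parent of $y$, and for all $d\in[D]$, $i\in[n^e]$ $$X^e_{d,i}=f_d\bigl(X^e_{\mathrm{PA}(d),i}\bigr)+\delta^e_{d,i},\qquad \delta^e_{d,i}=m_{d,i}+\sqrt{\Delta^e_{d,i}}\;\xi_{d,i},$$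 where $f_d$ is measurable and, if $y\in \mathrm{PA}(d)$, is a polynomial in $X^e_y$ (with coefficients that may be arbitrary functions of the other parents); $m_{d,i}\in\mathbb R$; $\xi_{d,i}$ has mean $0$ and variance $1$; $\Delta^e_{d,i}>0$; and $\delta^e_{d,i}$ is independent of $X^e_{u,i}$ for every non-descendant $u$ of $d$ (each node counts as a descendant of itself). *Parameters.* The parameters are $\theta=(\beta^v_{S^*},\beta^e_{S^*},\Delta^e)\in\Theta:=\mathbb R^{S^*}\times\mathbb R^{S^*}\times(0,\infty)^{D\times n^e}$. The graph, the functions $f_d$, the means $m_{d,i}$ and the random variables $\xi_{d,i}$, $\varepsilon^e_i$ do not depend on $\theta$; the data $(X^v,Y^v)$ of environment $v$ may depend on $(\beta^v,\Delta^e)$ in any jointly measurable way, but not on $\beta^e$; the data of the other environments may depend on $\theta$ arbitrarily. *Null hypothesis.* For $S\subseteq[D]$ let $\tilde\beta^a_S=\mathbf E[(X^a_S)^{t}X^a_S]^{\dagger}\,\mathbf E[(X^a_S)^{t}Y^a]$, where $\dagger$ is the Moore–Penrose inverse (and the fitted term $X^a_S\tilde\beta^a_S$ is $0$ for $S=\emptyset$).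 $H_{0,S}$ states that there is one distribution $F$ such that $Y^a_i-(X^a_S\tilde\beta^a_S)_i\sim F$ for all $a\in[E]$ and $i\in[n^a]$. **Theorem.** (i) For every $S\subseteq[D]$ with $S^*\not\subseteq S$ there is a Lebesgue-null set $M_0\subset\Theta$ such that for every $\theta\in\Theta\setminus M_0$ and all data satisfying the above at $\theta$, $H_{0,S}$ is false. (ii) Consequently there is a Lebesgue-null set $M_1\subset\Theta$ such that for every $\theta\in\Theta\setminus M_1$ and all data satisfying the above at $\theta$, $S^*=\bigcap\{S\subseteq[D] : H_{0,S}\text{ is true}\}$. No difference between the covariate distributions of the environments is assumed. -/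

import Mathlib

open MeasureTheory ProbabilityTheory

/-! ### The Moore–Penrose inverse of a real matrix -/

/-- `B` satisfies the four Penrose conditions for the real matrix `A`. -/
structure IsMoorePenrose {m n : Type*} [Fintype m] [Fintype n]
    (A : Matrix m n ℝ) (B : Matrix n m ℝ) : Prop where
  mul_mul_left : A * B * A = A
  mul_mul_right : B * A * B = B
  symm_left : (A * B).transpose = A * B
  symm_right : (B * A).transpose = B * A

theorem IsMoorePenrose.unique {m n : Type*} [Fintype m] [Fintype n]
    {A : Matrix m n ℝ} {B C : Matrix n m ℝ}
    (hB : IsMoorePenrose A B) (hC : IsMoorePenrose A C) : B = C := by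
  have h1 : A * B = A * C := by
    have : (A * C) * (A * B) = A * B := by
      rw [← Matrix.mul_assoc, hC.mul_mul_left]
    have h2 : (A * B) * (A * C) = A * C := by
      rw [← Matrix.mul_assoc, hB.mul_mul_left]
    calc A * B = (A * B).transpose := hB.symm_left.symm
      _ = ((A * C) * (A * B)).transpose := by rw [this]
      _ = (A * B) * (A * C) := by rw [Matrix.transpose_mul, hB.symm_left, hC.symm_left]
      _ = A * C := h2
  have h2 : B * A = C * A := by
    have h3 : (B * A) * (C * A) = B * A := by
      rw [Matrix.mul_assoc, ← Matrix.mul_assoc A, hC.mul_mul_left]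
    have h4 : (C * A) * (B * A) = C * A := by
      rw [Matrix.mul_assoc, ← Matrix.mul_assoc A, hB.mul_mul_left]
    calc B * A = (B * A).transpose := hB.symm_right.symm
      _ = ((B * A) * (C * A)).transpose := by rw [h3]
      _ = (C * A) * (B * A) := by rw [Matrix.transpose_mul, hB.symm_right, hC.symm_right]
      _ = C * A := h4
  calc B = B * A * B := hB.mul_mul_right.symm
    _ = C * A * B := by rw [h2]
    _ = C * A * C := by rw [Matrix.mul_assoc, h1, ← Matrix.mul_assoc]
    _ = C := hC.mul_mul_right

theorem exists_isMoorePenrose_of_isHermitian {n : Type*} [Fintype n]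
    (A : Matrix n n ℝ) (hA : A.IsHermitian) :
    ∃ B, IsMoorePenrose A B ∧ B.transpose = B := by
  classical
  set U : Matrix n n ℝ := (hA.eigenvectorUnitary : Matrix n n ℝ) with hU
  have hUU : U.transpose * U = 1 := by
    have := Unitary.coe_star_mul_self hA.eigenvectorUnitary
    rwa [Matrix.star_eq_conjTranspose, Matrix.conjTranspose_eq_transpose_of_trivial] at this
  have hs : A = U * Matrix.diagonal hA.eigenvalues * U.transpose := by
    have := hA.spectral_theorem
    rw [Unitary.conjStarAlgAut_apply, Matrix.star_eq_conjTranspose,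
      Matrix.conjTranspose_eq_transpose_of_trivial] at this
    exact this
  set l := hA.eigenvalues
  have key : ∀ p q : n → ℝ, (U * Matrix.diagonal p * U.transpose) *
      (U * Matrix.diagonal q * U.transpose)
        = U * Matrix.diagonal (fun i => p i * q i) * U.transpose := by
    intro p q
    calc _ = U * Matrix.diagonal p * (U.transpose * U) * Matrix.diagonal q * U.transpose := by
          simp only [Matrix.mul_assoc]
      _ = _ := by
          rw [hUU, Matrix.mul_one, Matrix.mul_assoc U, Matrix.diagonal_mul_diagonal]
  have tr : ∀ p : n → ℝ, (U * Matrix.diagonal p * U.transpose).transpose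
      = U * Matrix.diagonal p * U.transpose := by
    intro p
    simp [Matrix.transpose_mul, Matrix.mul_assoc]
  refine ⟨U * Matrix.diagonal (fun i => (l i)⁻¹) * U.transpose, ⟨?_, ?_, ?_, ?_⟩, tr _⟩
  · rw [hs, key, key]
    simp only [mul_inv_mul_cancel]
  · rw [hs, key, key]
    congr 3
    funext i
    by_cases h : l i = 0 <;> simp [h]
  · rw [hs, key, tr]
  · rw [hs, key, tr]

theorem exists_isMoorePenrose {m n : Type*} [Fintype m] [Fintype n] (A : Matrix m n ℝ) :
    ∃ B, IsMoorePenrose A B := by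
  classical
  have hH : (A.transpose * A).IsHermitian := by
    have := Matrix.isHermitian_conjTranspose_mul_self A
    rwa [Matrix.conjTranspose_eq_transpose_of_trivial] at this
  obtain ⟨K, hK, hKt⟩ := exists_isMoorePenrose_of_isHermitian _ hH
  have h1 : A * K * A.transpose * A = A := by
    have h : A.transpose * A * (K * A.transpose * A - 1) = 0 := by
      have := hK.mul_mul_left
      simp only [Matrix.mul_assoc, Matrix.mul_sub, Matrix.mul_one] at this ⊢
      rw [this, sub_self]
    have h' : A * (K * A.transpose * A - 1) = 0 := by
      rw [← Matrix.conjTranspose_mul_self_mul_eq_zero,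
        Matrix.conjTranspose_eq_transpose_of_trivial]
      exact h
    simp only [Matrix.mul_sub, Matrix.mul_one, sub_eq_zero] at h'
    simpa only [Matrix.mul_assoc] using h'
  refine ⟨K * A.transpose, ⟨?_, ?_, ?_, ?_⟩⟩
  · simpa only [Matrix.mul_assoc] using h1
  · have := hK.mul_mul_right
    calc _ = (K * (A.transpose * A) * K) * A.transpose := by simp only [Matrix.mul_assoc]
      _ = _ := by rw [this]
  · simp [Matrix.transpose_mul, hKt, Matrix.mul_assoc]
  · have := hK.symm_right
    simpa only [Matrix.mul_assoc] using this

/-- The Moore–Penrose inverse `A†` of a real matrix. -/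
noncomputable def moorePenrose {m n : Type*} [Fintype m] [Fintype n] (A : Matrix m n ℝ) :
    Matrix n m ℝ :=
  Classical.choose (exists_isMoorePenrose A)

theorem moorePenrose_spec {m n : Type*} [Fintype m] [Fintype n] (A : Matrix m n ℝ) :
    IsMoorePenrose A (moorePenrose A) :=
  Classical.choose_spec (exists_isMoorePenrose A)

/-! ### Environments, the invariant linear model and the null hypothesis -/

/-- The random data of one environment: `N` observations of `D` covariates and of the target.
`X i d` is the `d`-th covariate and `Y i` the target of observation `i`. -/
structure EnvData (Ω : Type*) (D N : ℕ) where
  X : Fin N → Fin D → Ω → ℝ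
  Y : Fin N → Ω → ℝ

/-- The noise `ε = Y - X β` of observation `i`. -/
def EnvData.targetNoise {Ω : Type*} {D N : ℕ} (Z : EnvData Ω D N) (b : Fin D → ℝ) (i : Fin N) :
    Ω → ℝ :=
  fun ω => Z.Y i ω - ∑ d, Z.X i d ω * b d

/-- The matrix `𝐄[X_Sᵗ X_S]`. -/
noncomputable def EnvData.gram {Ω : Type*} [MeasurableSpace Ω] (P : Measure Ω) {D N : ℕ}
    (Z : EnvData Ω D N) (S : Finset (Fin D)) : Matrix S S ℝ :=
  fun c d => ∫ ω, ∑ i, Z.X i c ω * Z.X i d ω ∂P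

/-- The vector `𝐄[X_Sᵗ Y]`. -/
noncomputable def EnvData.cross {Ω : Type*} [MeasurableSpace Ω] (P : Measure Ω) {D N : ℕ}
    (Z : EnvData Ω D N) (S : Finset (Fin D)) : S → ℝ :=
  fun c => ∫ ω, ∑ i, Z.X i c ω * Z.Y i ω ∂P

/-- The population regression coefficient `𝐄[X_Sᵗ X_S]† 𝐄[X_Sᵗ Y]`. -/
noncomputable def EnvData.regCoef {Ω : Type*} [MeasurableSpace Ω] (P : Measure Ω) {D N : ℕ}
    (Z : EnvData Ω D N) (S : Finset (Fin D)) : S → ℝ :=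
  (moorePenrose (Z.gram P S)).mulVec (Z.cross P S)

/-- The population residual of observation `i` when regressing the target on `X_S`. -/
noncomputable def EnvData.residual {Ω : Type*} [MeasurableSpace Ω] (P : Measure Ω) {D N : ℕ}
    (Z : EnvData Ω D N) (S : Finset (Fin D)) (i : Fin N) : Ω → ℝ :=
  fun ω => Z.Y i ω - ∑ d : S, Z.X i d ω * Z.regCoef P S d

/-- The null hypothesis `H_{0,S}`: one distribution is the law of all population residuals, over
all environments and all observations. -/
def NullHypothesis {Ω : Type*} [MeasurableSpace Ω] (P : Measure Ω) {E D : ℕ} {n : Fin E → ℕ}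
    (Z : (a : Fin E) → EnvData Ω D (n a)) (S : Finset (Fin D)) : Prop :=
  ∃ F : Measure ℝ, IsProbabilityMeasure F ∧ ∀ a i, HasLaw ((Z a).residual P S i) F P

/-- In every environment `a` the data satisfy `Y = X β^a + ε`, where `β^a` is supported on `Sstar`,
the entries of the noise `ε` have the zero-mean law `F` and are pairwise independent, and each entry
is independent of the covariates in `Sstar` of the same observation. -/
structure InvariantLinearModel {Ω : Type*} [MeasurableSpace Ω] (P : Measure Ω) {E D : ℕ}
    {n : Fin E → ℕ} (Sstar : Finset (Fin D)) (F : Measure ℝ) (β : Fin E → Fin D → ℝ)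
    (Z : (a : Fin E) → EnvData Ω D (n a)) : Prop where
  measurable_X : ∀ a i d, Measurable ((Z a).X i d)
  measurable_Y : ∀ a i, Measurable ((Z a).Y i)
  isProbabilityMeasure : IsProbabilityMeasure F
  integrable_id : Integrable id F
  mean_zero : ∫ x, x ∂F = 0
  coef_eq_zero : ∀ a d, d ∉ Sstar → β a d = 0
  noise_law : ∀ a i, HasLaw ((Z a).targetNoise (β a) i) F P
  noise_indep : ∀ a i j, i ≠ j →
    IndepFun ((Z a).targetNoise (β a) i) ((Z a).targetNoise (β a) j) P
  noise_indep_parents : ∀ a i,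
    IndepFun ((Z a).targetNoise (β a) i) (fun ω (d : Sstar) => (Z a).X i d ω) P

/-! ### The acyclic structural equation model of one environment -/

/-- The value at a node of the graph; `some d` is the `d`-th covariate, `none` is the target. -/
def EnvData.node {Ω : Type*} {D N : ℕ} (Z : EnvData Ω D N) (i : Fin N) :
    Option (Fin D) → Ω → ℝ
  | some d => Z.X i d
  | none => Z.Y i

/-- The ingredients of a structural equation model that do not vary with the parameters: the graph,
the structural functions, the means of the covariate noises, the covariate noises standardized to
mean zero and variance one, and the noise of the target. -/
structure Mechanism (Ω : Type*) (D N : ℕ) where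
  /-- `Edge a b` means that `a` is a parent of `b`. -/
  Edge : Option (Fin D) → Option (Fin D) → Prop
  f : (d : Fin D) → ({a : Option (Fin D) // Edge a (some d)} → ℝ) → ℝ
  mean : Fin N → Fin D → ℝ
  stdNoise : Fin N → Fin D → Ω → ℝ
  targetNoise : Fin N → Ω → ℝ

/-- `b` is a descendant of `a` (every node is a descendant of itself). -/
def Mechanism.Desc {Ω : Type*} {D N : ℕ} (M : Mechanism Ω D N) (a b : Option (Fin D)) : Prop :=
  Relation.ReflTransGen M.Edge a b

/-- The covariate noise with variance `Δ i d`. -/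
noncomputable def Mechanism.noise {Ω : Type*} {D N : ℕ} (M : Mechanism Ω D N)
    (Δ : Fin N → Fin D → ℝ) (i : Fin N) (d : Fin D) : Ω → ℝ :=
  fun ω => M.mean i d + √(Δ i d) * M.stdNoise i d ω

/-- The graph is acyclic and the members of `Sstar` are parents of the target; the structural
functions are polynomial in the target wherever the target is a parent; the standardized noises have
mean zero and variance one. -/
structure Mechanism.IsAdmissible {Ω : Type*} [MeasurableSpace Ω] (P : Measure Ω) {D N : ℕ}
    (Sstar : Finset (Fin D)) (M : Mechanism Ω D N) : Prop where
  acyclic : ∀ a, ¬ Relation.TransGen M.Edge a a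
  parents_target : ∀ d ∈ Sstar, M.Edge (some d) none
  measurable_f : ∀ d, Measurable (M.f d)
  polynomial_in_target : ∀ (d : Fin D) (h : M.Edge none (some d)),
    ∃ (k : ℕ) (c : Fin (k + 1) → ({a : Fin D // M.Edge (some a) (some d)} → ℝ) → ℝ),
      ∀ x, M.f d x = ∑ j, c j (fun a => x ⟨some a.1, a.2⟩) * x ⟨none, h⟩ ^ (j : ℕ)
  measurable_stdNoise : ∀ i d, Measurable (M.stdNoise i d)
  memLp_stdNoise : ∀ i d, MemLp (M.stdNoise i d) 2 P
  stdNoise_mean : ∀ i d, ∫ ω, M.stdNoise i d ω ∂P = 0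
  stdNoise_variance : ∀ i d, Var[M.stdNoise i d; P] = 1
  measurable_targetNoise : ∀ i, Measurable (M.targetNoise i)

/-- The data `Z` are generated by the structural equations of `M`, with target coefficients `b` and
noise variances `Δ`, each covariate noise being independent of each non-descendant. -/
structure Mechanism.Generates {Ω : Type*} [MeasurableSpace Ω] (P : Measure Ω) {D N : ℕ}
    (M : Mechanism Ω D N) (b : Fin D → ℝ) (Δ : Fin N → Fin D → ℝ) (Z : EnvData Ω D N) : Prop where
  covariate_eq : ∀ i d, ∀ᵐ ω ∂P,
    Z.X i d ω = M.f d (fun a => Z.node i a.1 ω) + M.noise Δ i d ω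
  target_eq : ∀ i, ∀ᵐ ω ∂P, Z.Y i ω = ∑ d, Z.X i d ω * b d + M.targetNoise i ω
  noise_indep : ∀ i d u, ¬ M.Desc (some d) u → IndepFun (M.noise Δ i d) (Z.node i u) P

/-! ### The parametrized family of models -/

/-- The parameters `(β^v, β^e, Δ^e)`; the first two are indexed by `Sstar`. -/
abbrev Params {D : ℕ} (Sstar : Finset (Fin D)) (N : ℕ) : Type :=
  (Sstar → ℝ) × (Sstar → ℝ) × (Fin N → Fin D → ℝ)

/-- The parameter region in which all variances are positive. -/
def Params.region {D : ℕ} (Sstar : Finset (Fin D)) (N : ℕ) : Set (Params Sstar N) :=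
  {θ | ∀ i d, 0 < θ.2.2 i d}

/-- The data of environment `v` as a jointly measurable function of `(β^v, Δ^e)` and `ω`. -/
structure MeasurableFamily {Ω : Type*} [MeasurableSpace Ω] {D N N' : ℕ} {Sstar : Finset (Fin D)}
    (V : (Sstar → ℝ) → (Fin N → Fin D → ℝ) → EnvData Ω D N') : Prop where
  measurable_X : ∀ i d, Measurable
    (fun p : ((Sstar → ℝ) × (Fin N → Fin D → ℝ)) × Ω => (V p.1.1 p.1.2).X i d p.2)
  measurable_Y : ∀ i, Measurable
    (fun p : ((Sstar → ℝ) × (Fin N → Fin D → ℝ)) × Ω => (V p.1.1 p.1.2).Y i p.2)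

/-- The data `Z` of all environments follow the model at the parameters `θ = (β^v, β^e, Δ^e)`: the
invariant linear model holds with coefficients that agree with `θ` in `v` and `e`, environment `e` is
generated by `M`, environment `v` is given by the family `V`, and all variables have finite
variance. Nothing else is required of the remaining environments. -/
structure FollowsModel {Ω : Type*} [MeasurableSpace Ω] (P : Measure Ω) {E D : ℕ}
    {n : Fin E → ℕ} (Sstar : Finset (Fin D)) (F : Measure ℝ) (e v : Fin E)
    (M : Mechanism Ω D (n e))
    (V : (Sstar → ℝ) → (Fin (n e) → Fin D → ℝ) → EnvData Ω D (n v))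
    (θ : Params Sstar (n e)) (β : Fin E → Fin D → ℝ)
    (Z : (a : Fin E) → EnvData Ω D (n a)) : Prop where
  linear : InvariantLinearModel P Sstar F β Z
  coef_v : ∀ d : Sstar, β v d = θ.1 d
  coef_e : ∀ d : Sstar, β e d = θ.2.1 d
  generates_e : M.Generates P (β e) θ.2.2 (Z e)
  data_v : Z v = V θ.1 θ.2.2
  memLp_X : ∀ a i d, MemLp ((Z a).X i d) 2 P
  memLp_Y : ∀ a i, MemLp ((Z a).Y i) 2 P

/-! Write y for the target and T for the nodes in S. Residuals with a common law have a common
second moment, so under `NullHypothesis` the total residual variances satisfy n^v R^e = n^e R^v.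
Since R^v may depend on Δ^e in an arbitrary measurable way, this is not an algebraic condition on
Δ^e. But R^v does not see β^e: two values of β^e that satisfy the equation at the same (β^v, Δ^e)
have equal R^e. Comparing such pairs eliminates environment v, and by Fubini
(`measure_prod_eq_zero_of_fibre_square`) the bad set is null once `coincidenceSet`, which concerns
environment e alone, is null within the regular parameters.

R^e is the ratio of the principal minors of the second-moment matrix on T ∪ {y} and on T, and
coincidence is stated with denominators cleared. It is treated by induction on T
(`measure_principalMinor_insert_eq`). If T contains descendants of y, let s be a last one. Changing
Δ_s to Δ_s + t in one observation shifts X_s there by x ξ_s, with x = √(Δ_s + t) - √Δ_s. As ξ_s is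
uncorrelated with y and the rest of T, only the diagonal entry at s changes, by x² + 2κx, and every
minor is affine in it with slope the minor without s (`principalMinor_corner`). Coincidence becomes
a quartic equation in x whose leading coefficient is the coincidence defect for T \ {s};
heuristically, a very noisy s does not help to predict y.

If T contains no descendant of y, take d ∈ S* \ S. Moving β^e_d by t adds t X_d to y and leaves T
unchanged, so the residual variance is quadratic in t. Its leading coefficient is the residual
variance of X_d given T, nonzero for almost all parameters by `measure_principalMinor_eq_zero`. In
both cases a set that meets each line of a fixed direction in finitely many points is null
(`measure_eq_zero_of_finite_lines`).

For (ii), the finitely many exceptional sets are united, and S* itself satisfies its null hypothesis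
because its residual is ε almost surely (`FollowsModel.nullHypothesis_parents`). -/

/-! ### Principal minors -/

/-- The principal minor of `G` on the index set `T`. -/
noncomputable def principalMinor {ι : Type*} [Fintype ι] [DecidableEq ι] (T : Finset ι)
    (G : Matrix ι ι ℝ) : ℝ :=
  (Matrix.of fun u w => if u ∈ T ∧ w ∈ T then G u w else if u = w then 1 else 0).det

section PrincipalMinor

variable {ι : Type*} [Fintype ι] [DecidableEq ι]

theorem principalMinor_empty (G : Matrix ι ι ℝ) : principalMinor ∅ G = 1 := by
  unfold principalMinor
  rw [← Matrix.det_one (n := ι) (R := ℝ)]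
  congr 1
  ext u w
  simp [Matrix.one_apply]

theorem principalMinor_congr {T : Finset ι} {G G' : Matrix ι ι ℝ}
    (h : ∀ u ∈ T, ∀ w ∈ T, G u w = G' u w) : principalMinor T G = principalMinor T G' := by
  unfold principalMinor
  congr 1
  ext u w
  by_cases hu : u ∈ T <;> by_cases hw : w ∈ T <;> simp [hu, hw, h]

theorem measurable_principalMinor {α : Type*} [MeasurableSpace α] {T : Finset ι}
    {G : α → Matrix ι ι ℝ} (h : ∀ u ∈ T, ∀ w ∈ T, Measurable fun x => G x u w) :
    Measurable fun x => principalMinor T (G x) := by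
  unfold principalMinor
  simp only [Matrix.det_apply, Matrix.of_apply]
  refine Finset.measurable_sum _ fun σ _ => Measurable.const_smul ?_ _
  refine Finset.measurable_prod _ fun i _ => ?_
  by_cases hu : σ i ∈ T ∧ i ∈ T
  · simp only [hu, and_self, if_true]
    exact h _ hu.1 _ hu.2
  · simp only [hu, if_false]
    exact measurable_const

/-- Multiples of the unit row `s` clear the rest of column `s` without changing the determinant. -/
theorem det_updateRow_single_self (A : Matrix ι ι ℝ) (s : ι) :
    (A.updateRow s (Pi.single s 1)).det =
      (Matrix.of fun u w => if u = s ∨ w = s then if u = w then 1 else 0 else A u w).det := by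
  refine Matrix.det_eq_of_forall_row_eq_smul_add_const (fun u => if u = s then 0 else A u s) s
    (by simp) fun u w => ?_
  by_cases hu : u = s
  · subst hu
    simp [Pi.single_apply, eq_comm]
  · by_cases hw : w = s
    · subst hw
      simp [hu]
    · simp [hu, hw, Ne.symm hw]

/-- The determinant is linear in row `s`, and that row changes by a multiple of a unit vector, whose
cofactor is the minor without `s`. -/
theorem principalMinor_corner {T : Finset ι} {s : ι} (hs : s ∈ T) {G G' : Matrix ι ι ℝ}
    (h : ∀ u ∈ T, ∀ w ∈ T, ¬ (u = s ∧ w = s) → G' u w = G u w) :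
    principalMinor T G' =
      principalMinor T G + (G' s s - G s s) * principalMinor (T.erase s) G := by
  set M : Matrix ι ι ℝ :=
    Matrix.of fun u w => if u ∈ T ∧ w ∈ T then G u w else if u = w then 1 else 0 with hM
  have h1 : principalMinor T G' =
      (M.updateRow s (M s + (G' s s - G s s) • Pi.single s 1)).det := by
    unfold principalMinor
    congr 1
    ext u w
    by_cases hu : u = s
    · subst hu
      by_cases hw : w = u
      · subst hw
        simp [hM, hs]
      · by_cases hwT : w ∈ T
        · simp [hM, hs, hwT, hw, h u hs w hwT]
        · simp [hM, hwT, hw]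
    · by_cases hT : u ∈ T ∧ w ∈ T
      · simp [hM, hT, hu, h u hT.1 w hT.2]
      · simp [hM, hT, hu]
  have h2 : (M.updateRow s (Pi.single s 1)).det = principalMinor (T.erase s) G := by
    rw [det_updateRow_single_self]
    unfold principalMinor
    congr 1
    ext u w
    by_cases hu : u = s <;> by_cases hw : w = s <;> simp [hu, hw, hM]
  rw [h1, Matrix.det_updateRow_add, Matrix.updateRow_eq_self, Matrix.det_updateRow_smul, h2]
  rfl

/-- The column combination with coefficients `1` at `y` and `-b` on `S` leaves only the Schur
complement in column `y`. For second moments this factor is the residual variance. Any solution `b`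
of the normal equations serves, so the minor on `S` may vanish. -/
theorem principalMinor_insert_of_normal {S : Finset ι} {y : ι} (hy : y ∉ S) {G : Matrix ι ι ℝ}
    (b : ι → ℝ) (h : ∀ u ∈ S, ∑ d ∈ S, G u d * b d = G u y) :
    principalMinor (insert y S) G = principalMinor S G * (G y y - ∑ d ∈ S, G y d * b d) := by
  set M : Matrix ι ι ℝ := Matrix.of fun u w =>
    if u ∈ insert y S ∧ w ∈ insert y S then G u w else if u = w then 1 else 0 with hM
  set c : ι → ℝ := fun d => if d = y then 1 else if d ∈ S then - b d else 0 with hc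
  have key : ∀ u, ∑ d, c d • M u d = (G y y - ∑ d ∈ S, G y d * b d) * (Pi.single y 1 : ι → ℝ) u := by
    intro u
    have hsum : ∑ d, c d • M u d = M u y - ∑ d ∈ S, M u d * b d := by
      have : ∀ d, c d • M u d =
          (if d = y then M u d else 0) - (if d ∈ S then M u d * b d else 0) := by
        intro d
        by_cases h1 : d = y
        · subst h1
          simp [hc, hy]
        · by_cases h2 : d ∈ S <;> simp [hc, h1, h2, mul_comm]
      rw [Finset.sum_congr rfl fun d _ => this d, Finset.sum_sub_distrib]
      simp
    rw [hsum]
    by_cases hu : u = y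
    · subst hu
      simp only [Pi.single_eq_same, mul_one]
      congr 1
      · simp [hM]
      · exact Finset.sum_congr rfl fun d hd => by simp [hM, hd]
    · rw [Pi.single_eq_of_ne hu, mul_zero]
      by_cases huS : u ∈ S
      · rw [sub_eq_zero]
        have : M u y = G u y := by simp [hM, huS]
        rw [this, ← h u huS]
        exact Finset.sum_congr rfl fun d hd => by simp [hM, hd, huS]
      · have h1 : M u y = 0 := by simp [hM, hu, huS]
        rw [h1, Finset.sum_eq_zero, sub_zero]
        intro d hd
        have : u ≠ d := fun h => huS (h ▸ hd)
        simp [hM, hu, huS, this]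
  have h1 : principalMinor (insert y S) G = M.det := rfl
  have h2 := Matrix.det_updateCol_sum M y c
  have h3 : (fun k => ∑ i, c i • M k i) =
      (G y y - ∑ d ∈ S, G y d * b d) • (Pi.single y 1 : ι → ℝ) := by
    funext k
    rw [key]
    rfl
  rw [h3, Matrix.det_updateCol_smul] at h2
  have h4 : (M.updateCol y (Pi.single y 1)).det = principalMinor S G := by
    rw [← Matrix.det_transpose, ← Matrix.updateRow_transpose, det_updateRow_single_self,
      ← Matrix.det_transpose]
    unfold principalMinor
    congr 1
    ext u w
    by_cases hu : u = y <;> by_cases hw : w = y <;>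
      simp [hu, hw, hM, hy, Ne.symm]
  rw [h4] at h2
  rw [h1]
  simp only [hc, if_true, one_smul] at h2
  rw [← h2, mul_comm]

theorem exists_normal_of_principalMinor_ne_zero {S : Finset ι} {G : Matrix ι ι ℝ}
    (hG : principalMinor S G ≠ 0) (r : ι → ℝ) :
    ∃ b : ι → ℝ, ∀ u ∈ S, ∑ d ∈ S, G u d * b d = r u := by
  set M : Matrix ι ι ℝ :=
    Matrix.of fun u w => if u ∈ S ∧ w ∈ S then G u w else if u = w then 1 else 0 with hM
  have hdet : IsUnit M.det := isUnit_iff_ne_zero.2 hG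
  refine ⟨M⁻¹.mulVec r, fun u hu => ?_⟩
  have h1 : M.mulVec (M⁻¹.mulVec r) u = r u := by
    rw [Matrix.mulVec_mulVec, Matrix.mul_nonsing_inv _ hdet, Matrix.one_mulVec]
  rw [← h1]
  simp only [Matrix.mulVec, dotProduct]
  rw [← Finset.sum_subset (Finset.subset_univ S)]
  · exact Finset.sum_congr rfl fun d hd => by simp [hM, hu, hd]
  · intro d _ hd
    have : u ≠ d := fun h => hd (h ▸ hu)
    simp [hM, hd, this]

end PrincipalMinor

/-! ### Zero sets of polynomials and null sets -/

theorem finite_setOf_quadratic_eq_zero {a : ℝ} (b c : ℝ) (ha : a ≠ 0) :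
    {x : ℝ | a * x ^ 2 + b * x + c = 0}.Finite := by
  have hp : Polynomial.C a * Polynomial.X ^ 2 + Polynomial.C b * Polynomial.X + Polynomial.C c
      ≠ 0 := fun h => ha (by simpa using congrArg (Polynomial.coeff · 2) h)
  refine (Polynomial.finite_setOfPred_isRoot hp).subset fun x hx => ?_
  simpa [Polynomial.IsRoot] using hx

theorem finite_setOf_quartic_eq_zero {a : ℝ} (b c d e : ℝ) (ha : a ≠ 0) :
    {x : ℝ | a * x ^ 4 + b * x ^ 3 + c * x ^ 2 + d * x + e = 0}.Finite := by
  have hp : Polynomial.C a * Polynomial.X ^ 4 + Polynomial.C b * Polynomial.X ^ 3 +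
      Polynomial.C c * Polynomial.X ^ 2 + Polynomial.C d * Polynomial.X + Polynomial.C e ≠ 0 :=
    fun h => ha (by
      simpa [Polynomial.coeff_X, Polynomial.coeff_C] using congrArg (Polynomial.coeff · 4) h)
  refine (Polynomial.finite_setOfPred_isRoot hp).subset fun x hx => ?_
  simpa [Polynomial.IsRoot] using hx

/-- Transfers finiteness from shifts of a standard deviation, in which the minors are polynomial, to
shifts of the variance, which is the parameter. The square root is injective where its argument is
positive. -/
theorem finite_setOf_sqrt_add_sub_mem {δ : ℝ} {A : Set ℝ} (hA : A.Finite) :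
    {t : ℝ | 0 < δ + t ∧ √(δ + t) - √δ ∈ A}.Finite := by
  refine Set.Finite.of_finite_image (f := fun t => √(δ + t) - √δ) (hA.subset ?_) ?_
  · rintro _ ⟨t, ht, rfl⟩
    exact ht.2
  · intro t ht t' ht' h
    have h1 : √(δ + t) = √(δ + t') := by simpa using h
    have h2 := (Real.sqrt_inj ht.1.le ht'.1.le).1 h1
    linarith

/-- Fubini in the direction `w`. Testing only base points in `T` makes the conditions that define
`T` available at the base point. -/
theorem measure_eq_zero_of_finite_lines {E : Type*} [NormedAddCommGroup E] [NormedSpace ℝ E]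
    [MeasurableSpace E] [BorelSpace E] [FiniteDimensional ℝ E] (μ : Measure E)
    [μ.IsAddHaarMeasure] {T : Set E} (hT : MeasurableSet T) (w : E)
    (h : ∀ y ∈ T, {t : ℝ | y + t • w ∈ T}.Finite) : μ T = 0 := by
  have h0 : ∀ y, {t : ℝ | y + t • w ∈ T}.Finite := by
    intro y
    by_cases hy : ∃ t₀ : ℝ, y + t₀ • w ∈ T
    · obtain ⟨t₀, ht₀⟩ := hy
      refine ((h _ ht₀).image (· + t₀)).subset fun t ht => ⟨t - t₀, ?_, by simp⟩
      have : y + t₀ • w + (t - t₀) • w = y + t • w := by rw [sub_smul]; abel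
      simpa [this] using ht
    · push Not at hy
      have : {t : ℝ | y + t • w ∈ T} = ∅ := by ext t; simp [hy t]
      simp [this]
  have h1 : ∀ᵐ y ∂μ, y ∈ Tᶜ := by
    refine ae_mem_of_ae_add_linearMap_mem (LinearMap.toSpanSingleton ℝ E w)
      (volume : Measure ℝ) μ hT.compl fun y => ?_
    have := (h0 y).measure_zero volume
    rw [ae_iff]
    simpa using this
  simpa [ae_iff] using h1

/-- A set whose fibre square is null is null. -/
theorem measure_prod_eq_zero_of_fibre_square {α β : Type*} [MeasurableSpace α] [MeasurableSpace β]
    {μ : Measure α} {ν : Measure β} [SFinite μ] [SFinite ν] {A : Set (α × β)}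
    (hA : MeasurableSet A)
    (h : μ.prod (μ.prod ν) {p | (p.1, p.2.2) ∈ A ∧ (p.2.1, p.2.2) ∈ A} = 0) :
    μ.prod ν A = 0 := by
  have m1 : MeasurableSet {p : α × (α × β) | (p.1, p.2.2) ∈ A ∧ (p.2.1, p.2.2) ∈ A} := by
    refine MeasurableSet.inter ?_ ?_
    · exact (by fun_prop : Measurable fun p : α × (α × β) => (p.1, p.2.2)) hA
    · exact (by fun_prop : Measurable fun p : α × (α × β) => (p.2.1, p.2.2)) hA
  have h1 : ∀ᵐ p ∂μ.prod (μ.prod ν), ¬ ((p.1, p.2.2) ∈ A ∧ (p.2.1, p.2.2) ∈ A) := by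
    rw [ae_iff]
    simpa using h
  -- The quantifiers are permuted until both copies `x`, `x'` range over the slice at one fixed `y`.
  have h2 : ∀ᵐ x ∂μ, ∀ᵐ y ∂ν, ∀ᵐ x' ∂μ, ¬ ((x, y) ∈ A ∧ (x', y) ∈ A) := by
    filter_upwards [Measure.ae_ae_of_ae_prod h1] with x hx
    have m2 : MeasurableSet {q : α × β | ¬ ((x, q.2) ∈ A ∧ (q.1, q.2) ∈ A)} :=
      (m1.preimage (measurable_prodMk_left (x := x))).compl
    exact (Measure.ae_ae_comm (p := fun x' y => ¬ ((x, y) ∈ A ∧ (x', y) ∈ A)) m2).1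
      (Measure.ae_ae_of_ae_prod hx)
  have h3 : ∀ᵐ y ∂ν, ∀ᵐ x ∂μ, ∀ᵐ x' ∂μ, ¬ ((x, y) ∈ A ∧ (x', y) ∈ A) := by
    refine (Measure.ae_ae_comm (p := fun x y => ∀ᵐ x' ∂μ, ¬ ((x, y) ∈ A ∧ (x', y) ∈ A)) ?_).1 h2
    have m3 : MeasurableSet {p : (α × β) × α | ((p.1.1, p.1.2) ∈ A ∧ (p.2, p.1.2) ∈ A)} := by
      refine MeasurableSet.inter ?_ ?_
      · exact (by fun_prop : Measurable fun p : (α × β) × α => (p.1.1, p.1.2)) hA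
      · exact (by fun_prop : Measurable fun p : (α × β) × α => (p.2, p.1.2)) hA
    have := measurableSet_eq_fun (measurable_measure_prodMk_left (ν := μ) m3)
      (measurable_const (a := 0))
    convert! this using 2
    simp [ae_iff]
  have h4 : ∀ᵐ y ∂ν, ∀ᵐ x ∂μ, (x, y) ∉ A := by
    filter_upwards [h3] with y hy
    -- If the slice were not null, it would contain an `x` that excludes almost every `x'` from it,
    -- which makes it null.
    by_contra hcon
    obtain ⟨x, hx, hxA⟩ := ((Filter.not_eventually.1 hcon).and_eventually hy).exists
    refine hcon ?_
    filter_upwards [hxA] with x' hx'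
    exact fun hA' => hx' ⟨not_not.1 hx, hA'⟩
  have h5 := (Measure.ae_ae_comm (p := fun x y => (x, y) ∉ A) (μ := μ) (ν := ν) hA.compl).2 h4
  rw [Measure.measure_prod_null hA]
  filter_upwards [h5] with x hx
  rw [ae_iff] at hx
  simp only [not_not] at hx
  exact hx

/-- Supplies a last node of a set: varying its noise leaves the other nodes of the set unchanged. -/
theorem exists_mem_forall_not_reflTransGen {α : Type*} [Finite α] {r : α → α → Prop}
    (hr : ∀ a, ¬ Relation.TransGen r a a) {S : Finset α} (hS : S.Nonempty) :
    ∃ s ∈ S, ∀ u ∈ S, u ≠ s → ¬ Relation.ReflTransGen r s u := by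
  have : IsTrans α (flip (Relation.TransGen r)) := ⟨fun _ _ _ h h' => Relation.TransGen.trans h' h⟩
  have : Std.Irrefl (flip (Relation.TransGen r)) := ⟨hr⟩
  have wf := Finite.wellFounded_of_trans_of_irrefl (flip (Relation.TransGen r))
  obtain ⟨s, hs, hmin⟩ := wf.has_min (S : Set α) hS
  refine ⟨s, hs, fun u hu hne h => hmin u hu ?_⟩
  rcases Relation.reflTransGen_iff_eq_or_transGen.1 h with h | h
  · exact absurd h hne
  · exact h

/-! ### The solution of the structural equations -/

section Solution

variable {Ω : Type*} [MeasurableSpace Ω] {P : Measure Ω} {D N : ℕ} {Sstar : Finset (Fin D)}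
  {M : Mechanism Ω D N}

theorem Mechanism.IsAdmissible.wellFounded (hM : M.IsAdmissible P Sstar) :
    WellFounded M.Edge := by
  have : IsTrans (Option (Fin D)) (Relation.TransGen M.Edge) :=
    ⟨fun _ _ _ h h' => Relation.TransGen.trans h h'⟩
  have : Std.Irrefl (Relation.TransGen M.Edge) := ⟨hM.acyclic⟩
  have wf := Finite.wellFounded_of_trans_of_irrefl (Relation.TransGen M.Edge)
  exact Subrelation.wf (fun h => Relation.TransGen.single h) wf

theorem Mechanism.IsAdmissible.not_desc_of_edge (hM : M.IsAdmissible P Sstar)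
    {a b : Option (Fin D)} (h : M.Edge a b) : ¬ M.Desc b a :=
  fun h' => hM.acyclic b (Relation.TransGen.tail' h' h)

/-- The solution of the structural equations for target coefficients `b` and variances `Δ`. -/
noncomputable def Mechanism.IsAdmissible.solution (hM : M.IsAdmissible P Sstar) (b : Sstar → ℝ)
    (Δ : Fin N → Fin D → ℝ) (i : Fin N) (ω : Ω) : Option (Fin D) → ℝ :=
  hM.wellFounded.fix fun u =>
    match u with
    | some d => fun rec => M.f d (fun a => rec a.1 a.2) + M.noise Δ i d ω
    | none => fun rec =>
        ∑ d : Sstar, rec (some d.1) (hM.parents_target d.1 d.2) * b d + M.targetNoise i ω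

theorem Mechanism.IsAdmissible.solution_some (hM : M.IsAdmissible P Sstar) (b : Sstar → ℝ)
    (Δ : Fin N → Fin D → ℝ) (i : Fin N) (ω : Ω) (d : Fin D) :
    hM.solution b Δ i ω (some d) =
      M.f d (fun a => hM.solution b Δ i ω a.1) + M.noise Δ i d ω := by
  conv_lhs => rw [solution, WellFounded.fix_eq]
  rfl

theorem Mechanism.IsAdmissible.solution_none (hM : M.IsAdmissible P Sstar) (b : Sstar → ℝ)
    (Δ : Fin N → Fin D → ℝ) (i : Fin N) (ω : Ω) :
    hM.solution b Δ i ω none =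
      ∑ d : Sstar, hM.solution b Δ i ω (some d.1) * b d + M.targetNoise i ω := by
  conv_lhs => rw [solution, WellFounded.fix_eq]
  rfl

theorem Mechanism.IsAdmissible.measurable_solution (hM : M.IsAdmissible P Sstar) (i : Fin N)
    (u : Option (Fin D)) :
    Measurable fun p : ((Sstar → ℝ) × (Fin N → Fin D → ℝ)) × Ω =>
      hM.solution p.1.1 p.1.2 i p.2 u := by
  induction u using hM.wellFounded.induction with
  | _ u ih =>
    cases u with
    | some d =>
      simp only [hM.solution_some, Mechanism.noise]
      have h1 := hM.measurable_stdNoise i d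
      refine Measurable.add ((hM.measurable_f d).comp
        (measurable_pi_lambda _ fun a => ih a.1 a.2)) ?_
      fun_prop
    | none =>
      simp only [hM.solution_none]
      have h1 := hM.measurable_targetNoise i
      refine Measurable.add (Finset.measurable_sum _ fun d _ => ?_) (by fun_prop)
      exact (ih _ (hM.parents_target d.1 d.2)).mul (by fun_prop)

theorem Mechanism.IsAdmissible.measurable_solution_right (hM : M.IsAdmissible P Sstar)
    (b : Sstar → ℝ) (Δ : Fin N → Fin D → ℝ) (i : Fin N) (u : Option (Fin D)) :
    Measurable fun ω => hM.solution b Δ i ω u :=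
  (hM.measurable_solution i u).comp (measurable_prodMk_left (x := (b, Δ)))

/-- The solution at a node only depends on the parameters of its ancestors. -/
theorem Mechanism.IsAdmissible.solution_congr (hM : M.IsAdmissible P Sstar) {b b' : Sstar → ℝ}
    {Δ Δ' : Fin N → Fin D → ℝ} (i : Fin N) (ω : Ω) (u : Option (Fin D))
    (hb : M.Desc none u → b' = b) (hΔ : ∀ d, M.Desc (some d) u → Δ' i d = Δ i d) :
    hM.solution b' Δ' i ω u = hM.solution b Δ i ω u := by
  induction u using hM.wellFounded.induction with
  | _ u ih =>
    have ih' : ∀ a, M.Edge a u → hM.solution b' Δ' i ω a = hM.solution b Δ i ω a :=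
      fun a ha => ih a ha (fun h => hb (h.tail ha)) fun d h => hΔ d (h.tail ha)
    cases u with
    | some d =>
      rw [hM.solution_some, hM.solution_some, Mechanism.noise, Mechanism.noise,
        hΔ d Relation.ReflTransGen.refl]
      congr 2
      exact funext fun a => ih' a.1 a.2
    | none =>
      obtain rfl := hb Relation.ReflTransGen.refl
      rw [hM.solution_none, hM.solution_none]
      congr 1
      exact Finset.sum_congr rfl fun d _ => congrArg (· * _) (ih' _ (hM.parents_target d.1 d.2))

/-- No parent of `s` descends from `s`, so the structural part stays fixed and only the noise term
moves. -/
theorem Mechanism.IsAdmissible.solution_update_noise (hM : M.IsAdmissible P Sstar)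
    {b : Sstar → ℝ} {Δ Δ' : Fin N → Fin D → ℝ} (i : Fin N) (ω : Ω) (s : Fin D)
    (hΔ : ∀ d, d ≠ s → Δ' i d = Δ i d) :
    hM.solution b Δ' i ω (some s) =
      hM.solution b Δ i ω (some s) + (√(Δ' i s) - √(Δ i s)) * M.stdNoise i s ω := by
  rw [hM.solution_some, hM.solution_some, Mechanism.noise, Mechanism.noise]
  have : (fun a : {a // M.Edge a (some s)} => hM.solution b Δ' i ω a.1) =
      fun a => hM.solution b Δ i ω a.1 := by
    funext a
    refine hM.solution_congr i ω _ (fun _ => rfl) fun d hd => hΔ d ?_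
    rintro rfl
    exact hM.not_desc_of_edge a.2 hd
  rw [this]
  ring

theorem Mechanism.IsAdmissible.solution_update_coef (hM : M.IsAdmissible P Sstar)
    {b : Sstar → ℝ} {Δ : Fin N → Fin D → ℝ} (i : Fin N) (ω : Ω) (d : Sstar) (t : ℝ) :
    hM.solution (b + t • Pi.single d 1) Δ i ω none =
      hM.solution b Δ i ω none + t * hM.solution b Δ i ω (some d.1) := by
  rw [hM.solution_none, hM.solution_none]
  have : ∀ c : Sstar, hM.solution (b + t • Pi.single d 1) Δ i ω (some c.1) =
      hM.solution b Δ i ω (some c.1) := fun c =>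
    hM.solution_congr i ω _
      (fun h => absurd h (hM.not_desc_of_edge (hM.parents_target c.1 c.2))) fun _ _ => rfl
  simp only [this, Pi.add_apply, Pi.smul_apply, smul_eq_mul, mul_add, Finset.sum_add_distrib]
  have : ∑ c : Sstar, hM.solution b Δ i ω (some c.1) * (t * (Pi.single d 1 : Sstar → ℝ) c) =
      t * hM.solution b Δ i ω (some d.1) := by
    rw [Finset.sum_eq_single d]
    · simp [mul_comm]
    · intro c _ hc
      simp [hc]
    · simp
  rw [this]
  ring

/-- Data generated by the mechanism agree almost surely with the solution. -/
theorem Mechanism.IsAdmissible.node_ae_eq_solution (hM : M.IsAdmissible P Sstar)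
    {b : Fin D → ℝ} {Δ : Fin N → Fin D → ℝ} {Z : EnvData Ω D N} (hb : ∀ d, d ∉ Sstar → b d = 0)
    (hZ : M.Generates P b Δ Z) (i : Fin N) (u : Option (Fin D)) :
    Z.node i u =ᵐ[P] fun ω => hM.solution (fun d => b d) Δ i ω u := by
  induction u using hM.wellFounded.induction with
  | _ u ih =>
    have ih' : ∀ᵐ ω ∂P, ∀ a, M.Edge a u →
        Z.node i a ω = hM.solution (fun d => b d) Δ i ω a :=
      ae_all_iff.2 fun a => by
        by_cases ha : M.Edge a u
        · filter_upwards [ih a ha] with ω hω _ using hω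
        · exact Filter.Eventually.of_forall fun ω h => absurd h ha
    cases u with
    | some d =>
      filter_upwards [ih', hZ.covariate_eq i d] with ω h1 h2
      rw [hM.solution_some]
      refine h2.trans ?_
      congr 2
      exact funext fun a => h1 a.1 a.2
    | none =>
      filter_upwards [ih', hZ.target_eq i] with ω h1 h2
      rw [hM.solution_none]
      refine h2.trans ?_
      congr 1
      have h3 : ∑ d, Z.X i d ω * b d = ∑ d ∈ Sstar, Z.X i d ω * b d :=
        (Finset.sum_subset (Finset.subset_univ _) fun d _ hd => by rw [hb d hd, mul_zero]).symm
      rw [h3, ← Finset.sum_coe_sort]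
      exact Finset.sum_congr rfl fun d _ => by
        rw [← h1 _ (hM.parents_target d.1 d.2)]
        rfl

/-! ### Second moments of the solution -/

theorem integrable_mul_of_memLp_two {Ω : Type*} [MeasurableSpace Ω] {P : Measure Ω} {f g : Ω → ℝ}
    (hf : MemLp f 2 P) (hg : MemLp g 2 P) : Integrable (fun ω => f ω * g ω) P :=
  hf.integrable_mul hg

/-- The matrix of second moments of the solution, summed over the observations. -/
noncomputable def Mechanism.IsAdmissible.moment (hM : M.IsAdmissible P Sstar) (b : Sstar → ℝ)
    (Δ : Fin N → Fin D → ℝ) : Matrix (Option (Fin D)) (Option (Fin D)) ℝ :=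
  fun u w => ∫ ω, ∑ i, hM.solution b Δ i ω u * hM.solution b Δ i ω w ∂P

theorem Mechanism.IsAdmissible.measurable_moment [IsProbabilityMeasure P]
    (hM : M.IsAdmissible P Sstar) (u w : Option (Fin D)) :
    Measurable fun q : (Sstar → ℝ) × (Fin N → Fin D → ℝ) => hM.moment q.1 q.2 u w := by
  have h : Measurable fun p : ((Sstar → ℝ) × (Fin N → Fin D → ℝ)) × Ω =>
      ∑ i, hM.solution p.1.1 p.1.2 i p.2 u * hM.solution p.1.1 p.1.2 i p.2 w :=
    Finset.measurable_sum _ fun i _ =>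
      (hM.measurable_solution i u).mul (hM.measurable_solution i w)
  exact h.stronglyMeasurable.integral_prod_right'.measurable

/-- The parameters at which the solution is square integrable and each standardized noise is
uncorrelated with the non-descendants. -/
def Mechanism.IsAdmissible.regularSet (hM : M.IsAdmissible P Sstar) :
    Set ((Sstar → ℝ) × (Fin N → Fin D → ℝ)) :=
  {q | (∀ i d, 0 < q.2 i d) ∧ (∀ i u, Integrable (fun ω => hM.solution q.1 q.2 i ω u ^ 2) P) ∧
    ∀ i d u, ¬ M.Desc (some d) u → ∫ ω, M.stdNoise i d ω * hM.solution q.1 q.2 i ω u ∂P = 0}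

theorem Mechanism.IsAdmissible.measurableSet_regularSet [IsProbabilityMeasure P]
    (hM : M.IsAdmissible P Sstar) : MeasurableSet hM.regularSet := by
  simp only [regularSet, Set.ofPred_and, Set.ofPred_forall]
  refine MeasurableSet.inter ?_ (MeasurableSet.inter ?_ ?_)
  · refine MeasurableSet.iInter fun i => MeasurableSet.iInter fun d => ?_
    exact measurableSet_lt measurable_const (by fun_prop)
  · refine MeasurableSet.iInter fun i => MeasurableSet.iInter fun u => ?_
    refine _root_.measurableSet_integrable (f := fun (q : (Sstar → ℝ) × (Fin N → Fin D → ℝ)) ω =>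
      hM.solution q.1 q.2 i ω u ^ 2) (μ := P) ?_
    exact ((hM.measurable_solution i u).pow_const 2).stronglyMeasurable
  · refine MeasurableSet.iInter fun i => MeasurableSet.iInter fun d => MeasurableSet.iInter fun u =>
      MeasurableSet.iInter fun _ => ?_
    refine measurableSet_eq_fun ?_ measurable_const
    have h : Measurable fun p : ((Sstar → ℝ) × (Fin N → Fin D → ℝ)) × Ω =>
        M.stdNoise i d p.2 * hM.solution p.1.1 p.1.2 i p.2 u :=
      ((hM.measurable_stdNoise i d).comp measurable_snd).mul (hM.measurable_solution i u)
    exact h.stronglyMeasurable.integral_prod_right'.measurable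

theorem Mechanism.IsAdmissible.memLp_solution (hM : M.IsAdmissible P Sstar) {b : Sstar → ℝ}
    {Δ : Fin N → Fin D → ℝ} (h : (b, Δ) ∈ hM.regularSet) (i : Fin N) (u : Option (Fin D)) :
    MemLp (fun ω => hM.solution b Δ i ω u) 2 P :=
  (memLp_two_iff_integrable_sq
    (hM.measurable_solution_right b Δ i u).aestronglyMeasurable).2 (h.2.1 i u)

theorem Mechanism.IsAdmissible.moment_comm (hM : M.IsAdmissible P Sstar) (b : Sstar → ℝ)
    (Δ : Fin N → Fin D → ℝ) (u w : Option (Fin D)) : hM.moment b Δ u w = hM.moment b Δ w u := by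
  simp only [moment, mul_comm]

theorem Mechanism.IsAdmissible.moment_eq_sum (hM : M.IsAdmissible P Sstar) {b : Sstar → ℝ}
    {Δ : Fin N → Fin D → ℝ} (h : (b, Δ) ∈ hM.regularSet) (u w : Option (Fin D)) :
    hM.moment b Δ u w = ∑ i, ∫ ω, hM.solution b Δ i ω u * hM.solution b Δ i ω w ∂P :=
  integral_finsetSum _ fun i _ =>
    integrable_mul_of_memLp_two (hM.memLp_solution h i u) (hM.memLp_solution h i w)

theorem Mechanism.IsAdmissible.integral_stdNoise_sq [IsProbabilityMeasure P]
    (hM : M.IsAdmissible P Sstar) (i : Fin N) (d : Fin D) :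
    ∫ ω, M.stdNoise i d ω ^ 2 ∂P = 1 := by
  have h := hM.stdNoise_variance i d
  rw [variance_eq_sub (hM.memLp_stdNoise i d), hM.stdNoise_mean i d] at h
  simpa using h

/-- The effect on the second moments of varying one noise variance. -/
theorem Mechanism.IsAdmissible.moment_update_noise [IsProbabilityMeasure P]
    (hM : M.IsAdmissible P Sstar) {b : Sstar → ℝ} {Δ Δ' : Fin N → Fin D → ℝ}
    (h : (b, Δ) ∈ hM.regularSet) {i₀ : Fin N} {s : Fin D}
    (hΔ : ∀ i d, ¬ (i = i₀ ∧ d = s) → Δ' i d = Δ i d) :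
    (∀ u w, ¬ M.Desc (some s) u → ¬ M.Desc (some s) w →
      hM.moment b Δ' u w = hM.moment b Δ u w) ∧
    (∀ u, ¬ M.Desc (some s) u → hM.moment b Δ' (some s) u = hM.moment b Δ (some s) u) ∧
    hM.moment b Δ' (some s) (some s) = hM.moment b Δ (some s) (some s) +
      ((√(Δ' i₀ s) - √(Δ i₀ s)) ^ 2 + 2 * (√(Δ' i₀ s) - √(Δ i₀ s)) *
        ∫ ω, M.stdNoise i₀ s ω * hM.solution b Δ i₀ ω (some s) ∂P) := by
  have h1 : ∀ i ω u, ¬ M.Desc (some s) u →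
      hM.solution b Δ' i ω u = hM.solution b Δ i ω u := by
    intro i ω u hu
    refine hM.solution_congr i ω u (fun _ => rfl) fun d hd => hΔ i d ?_
    rintro ⟨-, rfl⟩
    exact hu hd
  have h2 : ∀ i, i ≠ i₀ → ∀ ω u, hM.solution b Δ' i ω u = hM.solution b Δ i ω u :=
    fun i hi ω u => hM.solution_congr i ω u (fun _ => rfl) fun d _ => hΔ i d fun hh => hi hh.1
  set x := √(Δ' i₀ s) - √(Δ i₀ s) with hx
  have h3 : ∀ ω, hM.solution b Δ' i₀ ω (some s) =
      hM.solution b Δ i₀ ω (some s) + x * M.stdNoise i₀ s ω := fun ω =>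
    hM.solution_update_noise i₀ ω s fun d hd => hΔ i₀ d fun hh => hd hh.2
  have hξ := hM.memLp_stdNoise i₀ s
  have hL := fun i u => hM.memLp_solution h i u
  -- Regularity is not assumed at `Δ'`; square integrability of node `s` is inherited through the
  -- explicit shift `h3`.
  have hL' : ∀ i, MemLp (fun ω => hM.solution b Δ' i ω (some s)) 2 P := by
    intro i
    by_cases hi : i = i₀
    · subst hi
      simp only [h3]
      exact (hL i (some s)).add (hξ.const_mul x)
    · simp only [h2 i hi]
      exact hL i (some s)
  refine ⟨fun u w hu hw => ?_, fun u hu => ?_, ?_⟩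
  · simp only [moment, h1 _ _ u hu, h1 _ _ w hw]
  · rw [hM.moment_eq_sum h, moment]
    simp only [h1 _ _ u hu]
    rw [integral_finsetSum _ fun i _ => integrable_mul_of_memLp_two (hL' i) (hL i u)]
    refine Finset.sum_congr rfl fun i _ => ?_
    by_cases hi : i = i₀
    · subst hi
      have e1 : ∀ ω, hM.solution b Δ' i ω (some s) * hM.solution b Δ i ω u =
          hM.solution b Δ i ω (some s) * hM.solution b Δ i ω u +
            x * (M.stdNoise i s ω * hM.solution b Δ i ω u) := fun ω => by rw [h3]; ring
      simp only [e1]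
      rw [integral_add (integrable_mul_of_memLp_two (hL i (some s)) (hL i u))
        ((integrable_mul_of_memLp_two hξ (hL i u)).const_mul x), integral_const_mul, h.2.2 i s u hu]
      simp
    · simp only [h2 i hi]
  · rw [hM.moment_eq_sum h, moment, integral_finsetSum _ fun i _ => integrable_mul_of_memLp_two (hL' i) (hL' i),
      ← Finset.add_sum_erase _ _ (Finset.mem_univ i₀),
      ← Finset.add_sum_erase (f := fun i => ∫ ω, hM.solution b Δ i ω (some s) *
        hM.solution b Δ i ω (some s) ∂P) _ (Finset.mem_univ i₀), add_right_comm]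
    congr 1
    -- The integral of `ξ_s X_s` stays as an unknown coefficient: the noise is uncorrelated with
    -- each parent separately, which does not make it uncorrelated with `f_s` of all parents.
    · have e1 : ∀ ω, hM.solution b Δ' i₀ ω (some s) * hM.solution b Δ' i₀ ω (some s) =
          hM.solution b Δ i₀ ω (some s) * hM.solution b Δ i₀ ω (some s) +
            (x ^ 2 * M.stdNoise i₀ s ω ^ 2 +
              2 * x * (M.stdNoise i₀ s ω * hM.solution b Δ i₀ ω (some s))) :=
        fun ω => by rw [h3]; ring
      have i1 : Integrable (fun ω => x ^ 2 * M.stdNoise i₀ s ω ^ 2) P :=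
        hξ.integrable_sq.const_mul _
      have i2 := (integrable_mul_of_memLp_two hξ (hL i₀ (some s))).const_mul (2 * x)
      have i3 : Integrable (fun ω => x ^ 2 * M.stdNoise i₀ s ω ^ 2 +
          2 * x * (M.stdNoise i₀ s ω * hM.solution b Δ i₀ ω (some s))) P := i1.add i2
      simp only [e1]
      rw [integral_add (integrable_mul_of_memLp_two (hL i₀ (some s)) (hL i₀ (some s)))
        i3, integral_add i1 i2, integral_const_mul, integral_const_mul,
        hM.integral_stdNoise_sq, mul_one]
    · refine Finset.sum_congr rfl fun i hi => ?_
      simp only [h2 i (Finset.ne_of_mem_erase hi)]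

/-- The effect on principal minors of varying one noise variance. -/
theorem Mechanism.IsAdmissible.principalMinor_update_noise [IsProbabilityMeasure P]
    (hM : M.IsAdmissible P Sstar) {b : Sstar → ℝ} {Δ : Fin N → Fin D → ℝ}
    (h : (b, Δ) ∈ hM.regularSet) (i₀ : Fin N) {s : Fin D} {T : Finset (Option (Fin D))}
    (hs : some s ∈ T) (hT : ∀ u ∈ T, u ≠ some s → ¬ M.Desc (some s) u) (t : ℝ) :
    principalMinor T (hM.moment b (Δ + t • (Pi.single i₀ (Pi.single s 1) : Fin N → Fin D → ℝ))) =
      principalMinor T (hM.moment b Δ) + ((√(Δ i₀ s + t) - √(Δ i₀ s)) ^ 2 +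
        2 * (√(Δ i₀ s + t) - √(Δ i₀ s)) *
          ∫ ω, M.stdNoise i₀ s ω * hM.solution b Δ i₀ ω (some s) ∂P) *
        principalMinor (T.erase (some s)) (hM.moment b Δ) := by
  have hΔ : ∀ i d, ¬ (i = i₀ ∧ d = s) →
      (Δ + t • (Pi.single i₀ (Pi.single s 1) : Fin N → Fin D → ℝ) : Fin N → Fin D → ℝ) i d = Δ i d := by
    intro i d hid
    by_cases hi : i = i₀
    · subst hi
      have hd : d ≠ s := fun hd => hid ⟨rfl, hd⟩
      simp [hd]
    · simp [hi]
  have hs' : (Δ + t • (Pi.single i₀ (Pi.single s 1) : Fin N → Fin D → ℝ) : Fin N → Fin D → ℝ) i₀ s = Δ i₀ s + t := by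
    simp
  obtain ⟨h1, h2, h3⟩ := hM.moment_update_noise h hΔ
  rw [hs'] at h3
  rw [principalMinor_corner hs, h3, add_sub_cancel_left]
  intro u hu w hw huw
  by_cases hus : u = some s
  · subst hus
    exact h2 w (hT w hw fun hh => huw ⟨rfl, hh⟩)
  · by_cases hws : w = some s
    · subst hws
      rw [hM.moment_comm, h2 u (hT u hu hus), hM.moment_comm]
    · exact h1 u w (hT u hu hus) (hT w hw hws)

end Solution

/-! ### Null sets of parameters. -/

theorem isAddHaarMeasure_volume_params {D N : ℕ} (Sstar : Finset (Fin D)) :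
    (volume : Measure (Params Sstar N)).IsAddHaarMeasure := by
  have h0 : (volume : Measure (Fin D → ℝ)).IsAddHaarMeasure := inferInstance
  have h1 : (volume : Measure (Fin N → Fin D → ℝ)).IsAddHaarMeasure :=
    inferInstanceAs (Measure.pi fun _ : Fin N => (volume : Measure (Fin D → ℝ))).IsAddHaarMeasure
  have h2 : (volume : Measure (Sstar → ℝ)).IsAddHaarMeasure := inferInstance
  have h3 : (volume : Measure ((Sstar → ℝ) × (Fin N → Fin D → ℝ))).IsAddHaarMeasure :=
    Measure.prod.instIsAddHaarMeasure _ _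
  have i1 : MeasurableAdd ((Sstar → ℝ) × (Fin N → Fin D → ℝ)) := inferInstance
  exact Measure.prod.instIsAddHaarMeasure _ _

section NullSets

variable {Ω : Type*} [MeasurableSpace Ω] {P : Measure Ω} {D N : ℕ}
  {Sstar : Finset (Fin D)} {M : Mechanism Ω D N}

/-- The effect on the second moments of varying one coefficient of the target equation. -/
theorem Mechanism.IsAdmissible.moment_update_coef (hM : M.IsAdmissible P Sstar) {b : Sstar → ℝ}
    {Δ : Fin N → Fin D → ℝ} (h : (b, Δ) ∈ hM.regularSet) (d : Sstar) (t : ℝ) :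
    (∀ u w, ¬ M.Desc none u → ¬ M.Desc none w →
      hM.moment (b + t • Pi.single d 1) Δ u w = hM.moment b Δ u w) ∧
    (∀ u, ¬ M.Desc none u → hM.moment (b + t • Pi.single d 1) Δ u none =
      hM.moment b Δ u none + t * hM.moment b Δ u (some d.1)) ∧
    hM.moment (b + t • Pi.single d 1) Δ none none = hM.moment b Δ none none +
      2 * t * hM.moment b Δ none (some d.1) + t ^ 2 * hM.moment b Δ (some d.1) (some d.1) := by
  have h1 : ∀ i ω u, ¬ M.Desc none u →
      hM.solution (b + t • Pi.single d 1) Δ i ω u = hM.solution b Δ i ω u := fun i ω u hu =>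
    hM.solution_congr i ω u (fun hh => absurd hh hu) fun _ _ => rfl
  have h2 := fun i ω => hM.solution_update_coef (b := b) (Δ := Δ) i ω d t
  have hI : ∀ u w, Integrable (fun ω => ∑ i, hM.solution b Δ i ω u * hM.solution b Δ i ω w) P :=
    fun u w => integrable_finsetSum _ fun i _ =>
      integrable_mul_of_memLp_two (hM.memLp_solution h i u) (hM.memLp_solution h i w)
  refine ⟨fun u w hu hw => ?_, fun u hu => ?_, ?_⟩
  · simp only [moment, h1 _ _ u hu, h1 _ _ w hw]
  · simp only [moment, h1 _ _ u hu, h2, mul_add, Finset.sum_add_distrib]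
    rw [← integral_const_mul, ← integral_add (hI u none) ((hI u (some d.1)).const_mul t)]
    refine integral_congr_ae (Filter.Eventually.of_forall fun ω => ?_)
    simp only [Finset.mul_sum]
    congr 1
    exact Finset.sum_congr rfl fun i _ => by ring
  · simp only [moment, h2]
    rw [← integral_const_mul, ← integral_const_mul,
      ← integral_add (hI none none) ((hI none (some d.1)).const_mul (2 * t))]
    have i3 : Integrable (fun ω => ∑ i, hM.solution b Δ i ω none * hM.solution b Δ i ω none +
        2 * t * ∑ i, hM.solution b Δ i ω none * hM.solution b Δ i ω (some d.1)) P :=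
      (hI none none).add ((hI none (some d.1)).const_mul (2 * t))
    rw [← integral_add i3 ((hI (some d.1) (some d.1)).const_mul (t ^ 2))]
    refine integral_congr_ae (Filter.Eventually.of_forall fun ω => ?_)
    simp only [Finset.mul_sum, ← Finset.sum_add_distrib]
    exact Finset.sum_congr rfl fun i _ => by ring

theorem Mechanism.IsAdmissible.measurable_principalMinor_moment [IsProbabilityMeasure P]
    (hM : M.IsAdmissible P Sstar)
    (T : Finset (Option (Fin D))) :
    Measurable fun q : (Sstar → ℝ) × (Fin N → Fin D → ℝ) =>
      principalMinor T (hM.moment q.1 q.2) :=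
  measurable_principalMinor fun u _ w _ => hM.measurable_moment u w

/-- For almost all parameters the covariates are linearly independent. -/
theorem Mechanism.IsAdmissible.measure_principalMinor_eq_zero [IsProbabilityMeasure P]
    (hM : M.IsAdmissible P Sstar) (hN : 0 < N) (T : Finset (Option (Fin D))) (hT : none ∉ T) :
    (volume : Measure (Params Sstar N))
      {θ | θ.2 ∈ hM.regularSet ∧ principalMinor T (hM.moment θ.2.1 θ.2.2) = 0} = 0 := by
  have := isAddHaarMeasure_volume_params (N := N) Sstar
  induction T using Finset.strongInduction with
  | H T ih =>
    rcases T.eq_empty_or_nonempty with rfl | hne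
    · simp [principalMinor_empty]
    obtain ⟨_ | s, hs, hlast⟩ := exists_mem_forall_not_reflTransGen hM.acyclic hne
    · exact absurd hs hT
    have hnull := ih _ (Finset.erase_ssubset hs) fun hh => hT (Finset.mem_of_mem_erase hh)
    set G : Params Sstar N → Matrix _ _ ℝ := fun θ => hM.moment θ.2.1 θ.2.2 with hG
    have hmeas : ∀ T, Measurable fun θ : Params Sstar N => principalMinor T (G θ) := fun T =>
      (hM.measurable_principalMinor_moment T).comp measurable_snd
    have hreg : MeasurableSet {θ : Params Sstar N | θ.2 ∈ hM.regularSet} :=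
      measurable_snd hM.measurableSet_regularSet
    -- Along the variance of `s` in the single observation `0`, the minor on `T` is quadratic in the
    -- shift of the standard deviation, with leading coefficient the minor on `T \ {s}`.
    have hmain : (volume : Measure (Params Sstar N)) {θ | θ.2 ∈ hM.regularSet ∧
        principalMinor T (G θ) = 0 ∧ principalMinor (T.erase (some s)) (G θ) ≠ 0} = 0 := by
      refine measure_eq_zero_of_finite_lines volume ?_
        ((0, 0, Pi.single ⟨0, hN⟩ (Pi.single s 1)) : Params Sstar N) ?_
      · exact hreg.inter ((measurableSet_eq_fun (hmeas _) measurable_const).inter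
          (measurableSet_eq_fun (hmeas _) measurable_const).compl)
      · rintro ⟨b', b, Δ⟩ ⟨hr, h0, h1⟩
        refine (finite_setOf_sqrt_add_sub_mem (δ := Δ ⟨0, hN⟩ s)
          (finite_setOf_quadratic_eq_zero
            (2 * (∫ ω, M.stdNoise ⟨0, hN⟩ s ω * hM.solution b Δ ⟨0, hN⟩ ω (some s) ∂P) *
              principalMinor (T.erase (some s)) (hM.moment b Δ))
            (principalMinor T (hM.moment b Δ)) h1)).subset ?_
        rintro t ⟨hr', h0', -⟩
        simp only [hG, Prod.smul_mk, Prod.mk_add_mk, smul_zero, add_zero] at hr' h0'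
        refine ⟨by simpa using hr'.1 ⟨0, hN⟩ s, ?_⟩
        rw [hM.principalMinor_update_noise hr ⟨0, hN⟩ hs hlast t] at h0'
        simp only [Set.mem_ofPred_eq]
        rw [← h0']
        ring
    refine measure_mono_null ?_ (measure_union_null hnull hmain)
    rintro θ ⟨h1, h2⟩
    by_cases h3 : principalMinor (T.erase (some s)) (G θ) = 0
    · exact Or.inl ⟨h1, h3⟩
    · exact Or.inr ⟨h1, h2, h3⟩

/-- Along a line in the space of target coefficients the residual variance is not constant. -/
theorem Mechanism.IsAdmissible.finite_setOf_residual_eq_update_coef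
    (hM : M.IsAdmissible P Sstar) {b b' : Sstar → ℝ} {Δ : Fin N → Fin D → ℝ}
    (hr : (b, Δ) ∈ hM.regularSet) {d : Sstar} {T : Finset (Option (Fin D))} (hT : none ∉ T)
    (hnd : ∀ u ∈ T, ¬ M.Desc none u) (hd : some d.1 ∉ T)
    (h1 : principalMinor T (hM.moment b Δ) ≠ 0)
    (h2 : principalMinor (insert (some d.1) T) (hM.moment b Δ) ≠ 0) :
    {t : ℝ | principalMinor (insert none T) (hM.moment b' Δ) *
        principalMinor T (hM.moment (b + t • Pi.single d 1) Δ) =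
      principalMinor (insert none T) (hM.moment (b + t • Pi.single d 1) Δ) *
        principalMinor T (hM.moment b' Δ)}.Finite := by
  have hbb : principalMinor T (hM.moment b' Δ) = principalMinor T (hM.moment b Δ) := by
    refine principalMinor_congr fun u hu w hw => ?_
    simp only [moment]
    refine integral_congr_ae (Filter.Eventually.of_forall fun ω => ?_)
    refine Finset.sum_congr rfl fun i _ => ?_
    rw [hM.solution_congr (b := b) (b' := b') (Δ := Δ) (Δ' := Δ) i ω u
        (fun hh => absurd hh (hnd u hu)) fun _ _ => rfl,
      hM.solution_congr (b := b) (b' := b') (Δ := Δ) (Δ' := Δ) i ω w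
        (fun hh => absurd hh (hnd w hw)) fun _ _ => rfl]
  -- `p` and `q` are regression coefficients of y and of X_d on `T`. The moving target is y + t X_d,
  -- so `p + t q` solves its normal equations.
  obtain ⟨p, hp⟩ := exists_normal_of_principalMinor_ne_zero h1
    fun u => hM.moment b Δ u none
  obtain ⟨q, hq⟩ := exists_normal_of_principalMinor_ne_zero h1
    fun u => hM.moment b Δ u (some d.1)
  have hlead := principalMinor_insert_of_normal hd q hq
  set g := principalMinor T (hM.moment b Δ) with hg
  set γ := hM.moment b Δ (some d.1) (some d.1) -
    ∑ c ∈ T, hM.moment b Δ (some d.1) c * q c with hγ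
  -- `g * γ` is the minor on `T ∪ {d}`; the other factor `g` comes from clearing the denominator at
  -- `b'`.
  have hγ0 : g * γ * g ≠ 0 := by
    rw [hlead] at h2
    exact mul_ne_zero h2 h1
  have hcurve : ∀ t : ℝ,
      principalMinor T (hM.moment (b + t • Pi.single d 1) Δ) = g ∧
      principalMinor (insert none T) (hM.moment (b + t • Pi.single d 1) Δ) =
        g * (γ * t ^ 2 + (2 * hM.moment b Δ none (some d.1) -
            ∑ c ∈ T, hM.moment b Δ none c * q c -
            ∑ c ∈ T, hM.moment b Δ (some d.1) c * p c) * t +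
          (hM.moment b Δ none none - ∑ c ∈ T, hM.moment b Δ none c * p c)) := by
    intro t
    obtain ⟨m1, m2, m3⟩ := hM.moment_update_coef hr d t
    have hgt : principalMinor T (hM.moment (b + t • Pi.single d 1) Δ) = g :=
      principalMinor_congr fun u hu w hw => m1 u w (hnd u hu) (hnd w hw)
    refine ⟨hgt, ?_⟩
    rw [principalMinor_insert_of_normal hT (fun c => p c + t * q c) ?_, hgt, m3]
    · congr 1
      have : ∑ c ∈ T, hM.moment (b + t • Pi.single d 1) Δ none c * (p c + t * q c) =
          ∑ c ∈ T, hM.moment b Δ none c * p c +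
            t * ∑ c ∈ T, hM.moment b Δ none c * q c +
            t * ∑ c ∈ T, hM.moment b Δ (some d.1) c * p c +
            t ^ 2 * ∑ c ∈ T, hM.moment b Δ (some d.1) c * q c := by
        simp only [Finset.mul_sum, ← Finset.sum_add_distrib]
        refine Finset.sum_congr rfl fun c hc => ?_
        rw [hM.moment_comm, m2 c (hnd c hc), hM.moment_comm b Δ c none,
          hM.moment_comm b Δ c (some d.1)]
        ring
      rw [this, hγ]
      ring
    · intro u hu
      rw [m2 u (hnd u hu), ← hp u hu, ← hq u hu, Finset.mul_sum,
        ← Finset.sum_add_distrib]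
      refine Finset.sum_congr rfl fun c hc => ?_
      rw [m1 u c (hnd u hu) (hnd c hc)]
      ring
  refine (finite_setOf_quadratic_eq_zero
    (g * (2 * hM.moment b Δ none (some d.1) - ∑ c ∈ T, hM.moment b Δ none c * q c -
      ∑ c ∈ T, hM.moment b Δ (some d.1) c * p c) * g)
    (g * (hM.moment b Δ none none - ∑ c ∈ T, hM.moment b Δ none c * p c) * g -
      principalMinor (insert none T) (hM.moment b' Δ) * g) hγ0).subset ?_
  intro t ht
  rw [Set.mem_ofPred_eq, (hcurve t).1, (hcurve t).2, hbb] at ht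
  simp only [Set.mem_ofPred_eq]
  linear_combination -ht

/-- If the residual variances given `T` without its last element differ at two coefficient vectors,
then those given `T` agree for only finitely many variances of the last element. -/
theorem Mechanism.IsAdmissible.finite_setOf_residual_eq_update_noise [IsProbabilityMeasure P]
    (hM : M.IsAdmissible P Sstar) {b b' : Sstar → ℝ} {Δ : Fin N → Fin D → ℝ}
    (hr : (b, Δ) ∈ hM.regularSet) (hr' : (b', Δ) ∈ hM.regularSet) (i₀ : Fin N) {s : Fin D}
    {T : Finset (Option (Fin D))} (hsT : some s ∈ T)
    (hlastT : ∀ u ∈ T, u ≠ some s → ¬ M.Desc (some s) u) (hnone : ¬ M.Desc (some s) none)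
    (h1 : ¬ principalMinor (insert none (T.erase (some s))) (hM.moment b' Δ) *
        principalMinor (T.erase (some s)) (hM.moment b Δ) =
      principalMinor (insert none (T.erase (some s))) (hM.moment b Δ) *
        principalMinor (T.erase (some s)) (hM.moment b' Δ)) :
    {t : ℝ | 0 < Δ i₀ s + t ∧
      principalMinor (insert none T)
          (hM.moment b' (Δ + t • (Pi.single i₀ (Pi.single s 1) : Fin N → Fin D → ℝ))) *
        principalMinor T
          (hM.moment b (Δ + t • (Pi.single i₀ (Pi.single s 1) : Fin N → Fin D → ℝ))) =
      principalMinor (insert none T)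
          (hM.moment b (Δ + t • (Pi.single i₀ (Pi.single s 1) : Fin N → Fin D → ℝ))) *
        principalMinor T
          (hM.moment b' (Δ + t • (Pi.single i₀ (Pi.single s 1) : Fin N → Fin D → ℝ)))}.Finite := by
  have hlastT' : ∀ u ∈ insert none T, u ≠ some s → ¬ M.Desc (some s) u := by
    intro u hu hus
    rcases Finset.mem_insert.1 hu with rfl | hu
    · exact hnone
    · exact hlastT u hu hus
  have hsT' : some s ∈ insert none T := Finset.mem_insert_of_mem hsT
  have herase : (insert none T).erase (some s) = insert none (T.erase (some s)) :=
    Finset.erase_insert_of_ne (by simp)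
  set κ := ∫ ω, M.stdNoise i₀ s ω * hM.solution b Δ i₀ ω (some s) ∂P with hκ
  set κ' := ∫ ω, M.stdNoise i₀ s ω * hM.solution b' Δ i₀ ω (some s) ∂P with hκ'
  set c₁ := principalMinor (insert none T) (hM.moment b' Δ)
  set c₂ := principalMinor T (hM.moment b Δ)
  set c₃ := principalMinor (insert none T) (hM.moment b Δ)
  set c₄ := principalMinor T (hM.moment b' Δ)
  set e₁ := principalMinor (insert none (T.erase (some s))) (hM.moment b' Δ) with he₁
  set e₂ := principalMinor (T.erase (some s)) (hM.moment b Δ) with he₂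
  set e₃ := principalMinor (insert none (T.erase (some s))) (hM.moment b Δ) with he₃
  set e₄ := principalMinor (T.erase (some s)) (hM.moment b' Δ) with he₄
  -- With z = x² + 2κx and z' = x² + 2κ'x, these are the coefficients in x of (c₁ + z'e₁)(c₂ + ze₂)
  -- - (c₃ + ze₃)(c₄ + z'e₄).
  refine (finite_setOf_sqrt_add_sub_mem (δ := Δ i₀ s) (finite_setOf_quartic_eq_zero
    (2 * (κ + κ') * (e₁ * e₂ - e₃ * e₄))
    (4 * κ * κ' * (e₁ * e₂ - e₃ * e₄) + (e₁ * c₂ - c₃ * e₄) + (c₁ * e₂ - e₃ * c₄))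
    (2 * κ' * (e₁ * c₂ - c₃ * e₄) + 2 * κ * (c₁ * e₂ - e₃ * c₄))
    (c₁ * c₂ - c₃ * c₄) (sub_ne_zero.2 h1))).subset ?_
  rintro t ⟨h0t, ht⟩
  refine ⟨h0t, ?_⟩
  rw [hM.principalMinor_update_noise hr i₀ hsT hlastT t,
    hM.principalMinor_update_noise hr' i₀ hsT hlastT t,
    hM.principalMinor_update_noise hr i₀ hsT' hlastT' t,
    hM.principalMinor_update_noise hr' i₀ hsT' hlastT' t, herase,
    ← he₁, ← he₂, ← he₃, ← he₄, ← hκ, ← hκ'] at ht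
  simp only [Set.mem_ofPred_eq]
  linear_combination ht

/-- The parameters `(b', b, Δ)` such that the residual variances of the target given the nodes in
`T` agree at `b'` and `b`. -/
def Mechanism.IsAdmissible.coincidenceSet (hM : M.IsAdmissible P Sstar)
    (T : Finset (Option (Fin D))) : Set (Params Sstar N) :=
  {θ | principalMinor (insert none T) (hM.moment θ.1 θ.2.2) *
      principalMinor T (hM.moment θ.2.1 θ.2.2) =
    principalMinor (insert none T) (hM.moment θ.2.1 θ.2.2) *
      principalMinor T (hM.moment θ.1 θ.2.2)}

theorem measurable_params_fst_snd : Measurable fun θ : Params Sstar N => (θ.1, θ.2.2) :=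
  measurable_fst.prodMk (measurable_snd.comp measurable_snd)

theorem Mechanism.IsAdmissible.measurableSet_coincidenceSet [IsProbabilityMeasure P]
    (hM : M.IsAdmissible P Sstar) (T : Finset (Option (Fin D))) :
    MeasurableSet (hM.coincidenceSet T) := by
  have h1 := fun T => (hM.measurable_principalMinor_moment T).comp
    (measurable_snd : Measurable fun θ : Params Sstar N => θ.2)
  have h2 := fun T => (hM.measurable_principalMinor_moment T).comp
    (measurable_params_fst_snd (Sstar := Sstar) (N := N))
  exact measurableSet_eq_fun ((h2 _).mul (h1 _)) ((h1 _).mul (h2 _))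

/-- For almost all variances and almost all pairs of coefficient vectors, the residual variances of
the target given the nodes in `T` differ, unless `T` contains `Sstar`. -/
theorem Mechanism.IsAdmissible.measure_principalMinor_insert_eq [IsProbabilityMeasure P]
    (hM : M.IsAdmissible P Sstar) (hN : 0 < N) (d : Sstar) (T : Finset (Option (Fin D))) (hT : none ∉ T)
    (hd : some d.1 ∉ T) :
    (volume : Measure (Params Sstar N))
      {θ | (θ.1, θ.2.2) ∈ hM.regularSet ∧ θ.2 ∈ hM.regularSet ∧
        θ ∈ hM.coincidenceSet T} = 0 := by
  classical
  have := isAddHaarMeasure_volume_params (N := N) Sstar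
  induction T using Finset.strongInduction with
  | H T ih =>
    have hmeas : ∀ T, MeasurableSet {θ : Params Sstar N |
        principalMinor T (hM.moment θ.2.1 θ.2.2) ≠ 0} := fun T =>
      (measurableSet_eq_fun ((hM.measurable_principalMinor_moment T).comp measurable_snd)
        measurable_const).compl
    have hreg : MeasurableSet {θ : Params Sstar N | θ.2 ∈ hM.regularSet} :=
      measurable_snd hM.measurableSet_regularSet
    have hreg' : MeasurableSet {θ : Params Sstar N | (θ.1, θ.2.2) ∈ hM.regularSet} :=
      measurable_params_fst_snd hM.measurableSet_regularSet
    rcases (T.filter fun u => M.Desc none u).eq_empty_or_nonempty with hempty | hne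
    · have hnd : ∀ u ∈ T, ¬ M.Desc none u := fun u hu hh =>
        Finset.notMem_empty u (hempty ▸ Finset.mem_filter.2 ⟨hu, hh⟩)
      have hndd : ¬ M.Desc none (some d.1) :=
        hM.not_desc_of_edge (hM.parents_target d.1 d.2)
      have hn1 := hM.measure_principalMinor_eq_zero hN T hT
      have hn2 := hM.measure_principalMinor_eq_zero hN (insert (some d.1) T) (by simp [hT])
      have hmain : (volume : Measure (Params Sstar N))
          {θ | ((θ.1, θ.2.2) ∈ hM.regularSet ∧ θ.2 ∈ hM.regularSet ∧
            θ ∈ hM.coincidenceSet T) ∧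
            principalMinor T (hM.moment θ.2.1 θ.2.2) ≠ 0 ∧
              principalMinor (insert (some d.1) T) (hM.moment θ.2.1 θ.2.2) ≠ 0} = 0 := by
        refine measure_eq_zero_of_finite_lines volume ?_
          ((0, Pi.single d 1, 0) : Params Sstar N) ?_
        · exact (hreg'.inter (hreg.inter (hM.measurableSet_coincidenceSet T))).inter
            ((hmeas _).inter (hmeas _))
        · rintro ⟨b', b, Δ⟩ ⟨⟨hr', hr, -⟩, h1, h2⟩
          refine (hM.finite_setOf_residual_eq_update_coef (b' := b') hr hT hnd hd h1 h2).subset ?_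
          rintro t ⟨⟨-, -, ht⟩, -⟩
          simpa only [coincidenceSet, Set.mem_ofPred_eq, Prod.smul_mk, Prod.mk_add_mk, smul_zero, add_zero] using ht
      refine measure_mono_null ?_ (measure_union_null hmain (measure_union_null hn1 hn2))
      rintro θ ⟨h1, h2, h3⟩
      by_cases h4 : principalMinor T (hM.moment θ.2.1 θ.2.2) = 0
      · exact Or.inr (Or.inl ⟨h2, h4⟩)
      by_cases h5 : principalMinor (insert (some d.1) T) (hM.moment θ.2.1 θ.2.2) = 0
      · exact Or.inr (Or.inr ⟨h2, h5⟩)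
      exact Or.inl ⟨⟨h1, h2, h3⟩, h4, h5⟩
    · obtain ⟨_ | s, hs, hlast⟩ := exists_mem_forall_not_reflTransGen hM.acyclic hne
      · exact absurd (Finset.mem_filter.1 hs).1 hT
      obtain ⟨hsT, hsdesc⟩ := Finset.mem_filter.1 hs
      -- `s` is last only among the descendants of the target in `T`, but whatever lies below `s` is
      -- such a descendant too.
      have hlastT : ∀ u ∈ T, u ≠ some s → ¬ M.Desc (some s) u := fun u hu hus hh =>
        hlast u (Finset.mem_filter.2 ⟨hu, hsdesc.trans hh⟩) hus hh
      have hnone : ¬ M.Desc (some s) none := by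
        intro hh
        have : M.Desc none none := Relation.ReflTransGen.refl
        rcases Relation.reflTransGen_iff_eq_or_transGen.1 hsdesc with h | h
        · exact Option.some_ne_none s h
        · exact hM.acyclic none (h.trans_left hh)
      have hnull := ih _ (Finset.erase_ssubset hsT) (fun hh => hT (Finset.mem_of_mem_erase hh))
        fun hh => hd (Finset.mem_of_mem_erase hh)
      have hmain : (volume : Measure (Params Sstar N))
          {θ | ((θ.1, θ.2.2) ∈ hM.regularSet ∧ θ.2 ∈ hM.regularSet ∧
            θ ∈ hM.coincidenceSet T) ∧ θ ∉ hM.coincidenceSet (T.erase (some s))} = 0 := by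
        refine measure_eq_zero_of_finite_lines volume ?_
          ((0, 0, Pi.single ⟨0, hN⟩ (Pi.single s 1)) : Params Sstar N) ?_
        · exact (hreg'.inter (hreg.inter (hM.measurableSet_coincidenceSet T))).inter
            (hM.measurableSet_coincidenceSet _).compl
        · rintro ⟨b', b, Δ⟩ ⟨⟨hr', hr, -⟩, h1⟩
          refine (hM.finite_setOf_residual_eq_update_noise hr hr' ⟨0, hN⟩ hsT hlastT hnone
            h1).subset ?_
          rintro t ⟨⟨-, hrt, ht⟩, -⟩
          simp only [coincidenceSet, Set.mem_ofPred_eq, Prod.smul_mk, Prod.mk_add_mk, smul_zero,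
            add_zero] at ht hrt
          exact ⟨by simpa using hrt.1 ⟨0, hN⟩ s, ht⟩
      refine measure_mono_null ?_ (measure_union_null hmain hnull)
      rintro θ ⟨h1, h2, h3⟩
      by_cases h4 : θ ∈ hM.coincidenceSet (T.erase (some s))
      · exact Or.inr ⟨h1, h2, h4⟩
      · exact Or.inl ⟨⟨h1, h2, h3⟩, h4⟩

end NullSets

/-! ### Population regression -/

section Regression

variable {Ω : Type*} [MeasurableSpace Ω] {P : Measure Ω} {D N : ℕ}

/-- The inner product of two families of random variables indexed by the observations. -/
noncomputable def obsInner (P : Measure Ω) (f g : Fin N → Ω → ℝ) : ℝ :=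
  ∫ ω, ∑ i, f i ω * g i ω ∂P

theorem integrable_sum_mul {f g : Fin N → Ω → ℝ} (hf : ∀ i, MemLp (f i) 2 P)
    (hg : ∀ i, MemLp (g i) 2 P) : Integrable (fun ω => ∑ i, f i ω * g i ω) P :=
  integrable_finsetSum _ fun i _ => integrable_mul_of_memLp_two (hf i) (hg i)

theorem obsInner_comm (f g : Fin N → Ω → ℝ) : obsInner P f g = obsInner P g f := by
  simp only [obsInner, mul_comm]

theorem obsInner_add_right {f g h : Fin N → Ω → ℝ} (hf : ∀ i, MemLp (f i) 2 P)
    (hg : ∀ i, MemLp (g i) 2 P) (hh : ∀ i, MemLp (h i) 2 P) :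
    obsInner P f (fun i ω => g i ω + h i ω) = obsInner P f g + obsInner P f h := by
  simp only [obsInner, mul_add, Finset.sum_add_distrib]
  exact integral_add (integrable_sum_mul hf hg) (integrable_sum_mul hf hh)

theorem obsInner_sub_right {f g h : Fin N → Ω → ℝ} (hf : ∀ i, MemLp (f i) 2 P)
    (hg : ∀ i, MemLp (g i) 2 P) (hh : ∀ i, MemLp (h i) 2 P) :
    obsInner P f (fun i ω => g i ω - h i ω) = obsInner P f g - obsInner P f h := by
  simp only [obsInner, mul_sub, Finset.sum_sub_distrib]
  exact integral_sub (integrable_sum_mul hf hg) (integrable_sum_mul hf hh)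

theorem obsInner_sum_right {ι : Type*} [Fintype ι] {f : Fin N → Ω → ℝ}
    {g : ι → Fin N → Ω → ℝ} (hf : ∀ i, MemLp (f i) 2 P) (hg : ∀ d i, MemLp (g d i) 2 P)
    (c : ι → ℝ) :
    obsInner P f (fun i ω => ∑ d, g d i ω * c d) = ∑ d, obsInner P f (g d) * c d := by
  simp only [obsInner, ← integral_mul_const]
  rw [← integral_finsetSum _ fun d _ => (integrable_sum_mul hf (hg d)).mul_const (c d)]
  refine integral_congr_ae (Filter.Eventually.of_forall fun ω => ?_)
  simp only [Finset.mul_sum, Finset.sum_mul]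
  rw [Finset.sum_comm]
  exact Finset.sum_congr rfl fun d _ => Finset.sum_congr rfl fun i _ => by ring

theorem obsInner_self_nonneg (f : Fin N → Ω → ℝ) : 0 ≤ obsInner P f f :=
  integral_nonneg fun ω => Finset.sum_nonneg fun i _ => mul_self_nonneg (f i ω)

theorem ae_eq_zero_of_obsInner_self {f : Fin N → Ω → ℝ} (hf : ∀ i, MemLp (f i) 2 P)
    (h : obsInner P f f = 0) (i : Fin N) : ∀ᵐ ω ∂P, f i ω = 0 := by
  have h1 := (integral_eq_zero_iff_of_nonneg
    (fun ω => Finset.sum_nonneg fun i _ => mul_self_nonneg (f i ω))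
    (integrable_sum_mul hf hf)).1 h
  filter_upwards [h1] with ω hω
  have := (Finset.sum_eq_zero_iff_of_nonneg fun i _ => mul_self_nonneg (f i ω)).1 hω i
    (Finset.mem_univ i)
  exact mul_self_eq_zero.1 this

variable {Z : EnvData Ω D N} {S : Finset (Fin D)}

theorem memLp_fit (hX : ∀ i d, MemLp (Z.X i d) 2 P) (c : S → ℝ) (i : Fin N) :
    MemLp (fun ω => ∑ d : S, Z.X i d ω * c d) 2 P :=
  memLp_finsetSum _ fun d _ => (hX i d).mul_const (c d)

theorem EnvData.memLp_residual (hX : ∀ i d, MemLp (Z.X i d) 2 P) (hY : ∀ i, MemLp (Z.Y i) 2 P)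
    (i : Fin N) : MemLp (Z.residual P S i) 2 P :=
  (hY i).sub (memLp_fit hX _ i)

theorem obsInner_fit_right (hX : ∀ i d, MemLp (Z.X i d) 2 P) {f : Fin N → Ω → ℝ}
    (hf : ∀ i, MemLp (f i) 2 P) (c : S → ℝ) :
    obsInner P f (fun i ω => ∑ d : S, Z.X i d ω * c d) =
      ∑ d : S, obsInner P f (fun i => Z.X i d) * c d :=
  obsInner_sum_right (g := fun (d : S) i => Z.X i d) hf (fun d i => hX i d) c

/-- A vector in the kernel of the Gram matrix gives a vanishing linear combination. -/
theorem EnvData.ae_fit_eq_zero (hX : ∀ i d, MemLp (Z.X i d) 2 P) {w : S → ℝ}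
    (hw : (Z.gram P S).mulVec w = 0) (i : Fin N) :
    ∀ᵐ ω ∂P, ∑ d : S, Z.X i d ω * w d = 0 := by
  refine ae_eq_zero_of_obsInner_self (f := fun i ω => ∑ d : S, Z.X i d ω * w d)
    (memLp_fit hX w) ?_ i
  rw [obsInner_fit_right hX (memLp_fit hX w)]
  refine Finset.sum_eq_zero fun c _ => ?_
  rw [obsInner_comm, obsInner_fit_right hX fun i => hX i c]
  have := congrFun hw c
  simp only [Matrix.mulVec, dotProduct, Pi.zero_apply] at this
  have h2 : ∑ d : S, obsInner P (fun i => Z.X i c) (fun i => Z.X i d) * w d = 0 := this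
  rw [h2, zero_mul]

/-- The normal equations are solvable even for a singular Gram matrix. The part `w` of the cross
moments orthogonal to the range lies in the kernel, so the combination of covariates with weights
`w` vanishes almost surely. Hence `w` is orthogonal to the cross moments, and so to itself. -/
theorem EnvData.gram_mulVec_regCoef (hX : ∀ i d, MemLp (Z.X i d) 2 P)
    (hY : ∀ i, MemLp (Z.Y i) 2 P) : (Z.gram P S).mulVec (Z.regCoef P S) = Z.cross P S := by
  set A := Z.gram P S with hA
  have hsymm : A.transpose = A := by
    ext c d
    simp only [hA, EnvData.gram, Matrix.transpose_apply, mul_comm]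
  have hp := moorePenrose_spec A
  set B := A * moorePenrose A with hB
  set w := Z.cross P S - B.mulVec (Z.cross P S) with hw
  have hAB : A * B = A := by
    have h := congrArg Matrix.transpose hp.mul_mul_left
    rwa [Matrix.transpose_mul, hp.symm_left, hsymm] at h
  have hAw : A.mulVec w = 0 := by
    rw [hw, Matrix.mulVec_sub, Matrix.mulVec_mulVec, hAB, sub_self]
  have hBw : B.mulVec w = 0 := by
    have : B * B = B := by
      rw [hB, ← Matrix.mul_assoc, hp.mul_mul_left]
    rw [hw, Matrix.mulVec_sub, Matrix.mulVec_mulVec, this, sub_self]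
  have hcw : Z.cross P S ⬝ᵥ w = 0 := by
    have h1 : obsInner P Z.Y (fun i ω => ∑ d : S, Z.X i d ω * w d) = 0 := by
      refine integral_eq_zero_of_ae ?_
      filter_upwards [ae_all_iff.2 (EnvData.ae_fit_eq_zero hX hAw)] with ω hω
      exact Finset.sum_eq_zero fun i _ => by simp only [hω i, mul_zero]
    rw [obsInner_fit_right hX hY] at h1
    rw [← h1]
    simp only [dotProduct]
    refine Finset.sum_congr rfl fun d _ => ?_
    rw [obsInner_comm]
    rfl
  have hww : w ⬝ᵥ w = 0 := by
    nth_rewrite 1 [hw]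
    rw [sub_dotProduct, hcw, zero_sub, neg_eq_zero,
      ← (show B.transpose = B from hp.symm_left), Matrix.mulVec_transpose, ← Matrix.dotProduct_mulVec, hBw, dotProduct_zero]
  have hw0 : w = 0 := dotProduct_self_eq_zero.1 hww
  rw [EnvData.regCoef, Matrix.mulVec_mulVec]
  exact (sub_eq_zero.1 hw0).symm

theorem EnvData.obsInner_residual (hX : ∀ i d, MemLp (Z.X i d) 2 P)
    (hY : ∀ i, MemLp (Z.Y i) 2 P) (c : S) :
    obsInner P (fun i => Z.X i c) (Z.residual P S) = 0 := by
  have h1 := congrFun (EnvData.gram_mulVec_regCoef (S := S) hX hY) c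
  have h2 : obsInner P (fun i => Z.X i c) (Z.residual P S) = _ :=
    obsInner_sub_right (fun i => hX i c) hY (memLp_fit hX (Z.regCoef P S))
  rw [h2, obsInner_fit_right hX fun i => hX i c, sub_eq_zero]
  exact h1.symm

theorem EnvData.obsInner_residual_self (hX : ∀ i d, MemLp (Z.X i d) 2 P)
    (hY : ∀ i, MemLp (Z.Y i) 2 P) :
    obsInner P (Z.residual P S) (Z.residual P S) =
      obsInner P Z.Y Z.Y - ∑ d : S, obsInner P Z.Y (fun i => Z.X i d) * Z.regCoef P S d := by
  have hR := EnvData.memLp_residual (S := S) hX hY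
  have h1 : obsInner P (Z.residual P S) (Z.residual P S) = _ :=
    obsInner_sub_right hR hY (memLp_fit hX (Z.regCoef P S))
  have h2 : obsInner P Z.Y (Z.residual P S) = _ :=
    obsInner_sub_right hY hY (memLp_fit hX (Z.regCoef P S))
  have h3 : ∑ d : S, obsInner P (Z.residual P S) (fun i => Z.X i d) * Z.regCoef P S d = 0 :=
    Finset.sum_eq_zero fun d _ => by
      rw [obsInner_comm, EnvData.obsInner_residual hX hY, zero_mul]
  rw [h1, obsInner_fit_right hX hR, h3, sub_zero, obsInner_comm, h2, obsInner_fit_right hX hY]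

/-- The risk of a linear predictor as a quadratic function of its coefficients. -/
theorem EnvData.risk_eq (hX : ∀ i d, MemLp (Z.X i d) 2 P) (hY : ∀ i, MemLp (Z.Y i) 2 P)
    (b : S → ℝ) :
    ∫ ω, ∑ i, (Z.Y i ω - ∑ d : S, Z.X i d ω * b d) ^ 2 ∂P =
      obsInner P (Z.residual P S) (Z.residual P S) +
        obsInner P (fun i ω => ∑ d : S, Z.X i d ω * (Z.regCoef P S d - b d))
          (fun i ω => ∑ d : S, Z.X i d ω * (Z.regCoef P S d - b d)) := by
  have hR := EnvData.memLp_residual (S := S) hX hY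
  set c : S → ℝ := fun d => Z.regCoef P S d - b d with hc
  have hf := memLp_fit hX c
  have h0 : obsInner P (Z.residual P S) (fun i ω => ∑ d : S, Z.X i d ω * c d) = 0 := by
    rw [obsInner_fit_right hX hR, Finset.sum_eq_zero]
    intro d _
    rw [obsInner_comm, EnvData.obsInner_residual hX hY, zero_mul]
  have h0' : obsInner P (fun i ω => ∑ d : S, Z.X i d ω * c d) (Z.residual P S) = 0 :=
    (obsInner_comm _ _).trans h0
  have h1 : ∀ i ω, Z.Y i ω - ∑ d : S, Z.X i d ω * b d =
      Z.residual P S i ω + ∑ d : S, Z.X i d ω * c d := by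
    intro i ω
    simp only [EnvData.residual, hc, mul_sub, Finset.sum_sub_distrib]
    ring
  have hRf : ∀ i, MemLp (fun ω => Z.residual P S i ω + ∑ d : S, Z.X i d ω * c d) 2 P :=
    fun i => (hR i).add (hf i)
  calc _ = obsInner P (fun i ω => Z.residual P S i ω + ∑ d : S, Z.X i d ω * c d)
        (fun i ω => Z.residual P S i ω + ∑ d : S, Z.X i d ω * c d) := by
        simp only [obsInner, h1, sq]
    _ = _ := by
        rw [obsInner_add_right hRf hR hf, obsInner_comm, obsInner_add_right hR hR hf, h0,
          obsInner_comm (fun i ω => Z.residual P S i ω + _), obsInner_add_right hf hR hf,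
          h0', add_zero, zero_add]

/-- The minimal risk of linear prediction of the target from the covariates in `S`. -/
noncomputable def EnvData.minRisk (P : Measure Ω) (Z : EnvData Ω D N) (S : Finset (Fin D)) :
    ENNReal :=
  ⨅ b : S → ℚ, ∫⁻ ω, ENNReal.ofReal (∑ i, (Z.Y i ω - ∑ d : S, Z.X i d ω * (b d : ℝ)) ^ 2) ∂P

/-- By `EnvData.risk_eq` the risk is continuous in the coefficients and least at `regCoef`; density
of the rational vectors does the rest. -/
theorem EnvData.minRisk_eq (hX : ∀ i d, MemLp (Z.X i d) 2 P) (hY : ∀ i, MemLp (Z.Y i) 2 P) :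
    Z.minRisk P S = ENNReal.ofReal (obsInner P (Z.residual P S) (Z.residual P S)) := by
  have hrisk : ∀ b : S → ℝ,
      ∫⁻ ω, ENNReal.ofReal (∑ i, (Z.Y i ω - ∑ d : S, Z.X i d ω * b d) ^ 2) ∂P =
        ENNReal.ofReal (obsInner P (Z.residual P S) (Z.residual P S) +
        obsInner P (fun i ω => ∑ d : S, Z.X i d ω * (Z.regCoef P S d - b d))
          (fun i ω => ∑ d : S, Z.X i d ω * (Z.regCoef P S d - b d))) := by
    intro b
    rw [← EnvData.risk_eq hX hY b, ofReal_integral_eq_lintegral_ofReal]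
    · exact integrable_finsetSum _ fun i _ => ((hY i).sub (memLp_fit hX b i)).integrable_sq
    · exact Filter.Eventually.of_forall fun ω => Finset.sum_nonneg fun i _ => sq_nonneg _
  refine le_antisymm ?_ (le_iInf fun b => ?_)
  · have hden : DenseRange (Pi.map fun (_ : S) (q : ℚ) => (q : ℝ)) :=
      DenseRange.piMap fun _ => Rat.denseRange_cast
    have hall : ∀ b : S → ℝ, Z.minRisk P S ≤
        ENNReal.ofReal (obsInner P (Z.residual P S) (Z.residual P S) +
        obsInner P (fun i ω => ∑ d : S, Z.X i d ω * (Z.regCoef P S d - b d))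
          (fun i ω => ∑ d : S, Z.X i d ω * (Z.regCoef P S d - b d))) := by
      intro b
      refine hden.induction_on (p := fun b : S → ℝ => Z.minRisk P S ≤
        ENNReal.ofReal (obsInner P (Z.residual P S) (Z.residual P S) +
        obsInner P (fun i ω => ∑ d : S, Z.X i d ω * (Z.regCoef P S d - b d))
          (fun i ω => ∑ d : S, Z.X i d ω * (Z.regCoef P S d - b d)))) b ?_ fun q => ?_
      · have e : ∀ b : S → ℝ,
            obsInner P (fun i ω => ∑ d : S, Z.X i d ω * (Z.regCoef P S d - b d))
              (fun i ω => ∑ d : S, Z.X i d ω * (Z.regCoef P S d - b d)) =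
            ∑ c : S, (∑ d : S, obsInner P (fun i => Z.X i c) (fun i => Z.X i d) *
              (Z.regCoef P S d - b d)) * (Z.regCoef P S c - b c) := by
          intro b
          rw [obsInner_fit_right hX (memLp_fit hX fun d => Z.regCoef P S d - b d)]
          refine Finset.sum_congr rfl fun c _ => ?_
          rw [obsInner_comm, obsInner_fit_right hX fun i => hX i c]
        simp only [e]
        exact isClosed_le continuous_const (ENNReal.continuous_ofReal.comp (by fun_prop))
      · rw [← hrisk]
        exact iInf_le _ q
    refine (hall (Z.regCoef P S)).trans (le_of_eq ?_)
    simp [obsInner]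
  · rw [hrisk fun d => (b d : ℝ)]
    exact ENNReal.ofReal_le_ofReal (le_add_of_nonneg_right (obsInner_self_nonneg _))

/-- Rational coefficients and extended values are there for this: a countable infimum of lower
Lebesgue integrals is measurable in the parameters, without integrability and without studying the
pseudo-inverse. -/
theorem measurable_minRisk [IsProbabilityMeasure P] {N' : ℕ} {Sstar : Finset (Fin D)}
    {V : (Sstar → ℝ) → (Fin N → Fin D → ℝ) → EnvData Ω D N'} (hV : MeasurableFamily V)
    (S : Finset (Fin D)) :
    Measurable fun q : (Sstar → ℝ) × (Fin N → Fin D → ℝ) => (V q.1 q.2).minRisk P S := by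
  refine Measurable.iInf fun b => ?_
  have h : Measurable fun p : ((Sstar → ℝ) × (Fin N → Fin D → ℝ)) × Ω =>
      ENNReal.ofReal (∑ i, ((V p.1.1 p.1.2).Y i p.2 -
        ∑ d : S, (V p.1.1 p.1.2).X i d p.2 * (b d : ℝ)) ^ 2) := by
    refine ENNReal.measurable_ofReal.comp (Finset.measurable_sum _ fun i _ => ?_)
    refine Measurable.pow_const ((hV.measurable_Y i).sub ?_) 2
    exact Finset.measurable_sum _ fun d _ => (hV.measurable_X i d).mul_const _
  exact h.lintegral_prod_right'

end Regression

/-! ### The null hypothesis -/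

section Model

variable {Ω : Type*} [MeasurableSpace Ω] {P : Measure Ω} {E D : ℕ} {n : Fin E → ℕ}
  {Sstar : Finset (Fin D)} {F : Measure ℝ} {e v : Fin E} {M : Mechanism Ω D (n e)}
  {V : (Sstar → ℝ) → (Fin (n e) → Fin D → ℝ) → EnvData Ω D (n v)}
  {θ : Params Sstar (n e)} {β : Fin E → Fin D → ℝ} {Z : (a : Fin E) → EnvData Ω D (n a)}

theorem FollowsModel.node_ae_eq_solution (hM : M.IsAdmissible P Sstar)
    (h : FollowsModel P Sstar F e v M V θ β Z) (i : Fin (n e)) (u : Option (Fin D)) :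
    (Z e).node i u =ᵐ[P] fun ω => hM.solution θ.2.1 θ.2.2 i ω u := by
  have h1 : θ.2.1 = fun d : Sstar => β e d := funext fun d => (h.coef_e d).symm
  rw [h1]
  exact hM.node_ae_eq_solution (h.linear.coef_eq_zero e) h.generates_e i u

theorem FollowsModel.memLp_node (h : FollowsModel P Sstar F e v M V θ β Z) (i : Fin (n e))
    (u : Option (Fin D)) : MemLp ((Z e).node i u) 2 P := by
  cases u with
  | some d => exact h.memLp_X e i d
  | none => exact h.memLp_Y e i

theorem FollowsModel.mem_regularSet [IsProbabilityMeasure P] (hM : M.IsAdmissible P Sstar)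
    (h : FollowsModel P Sstar F e v M V θ β Z) (hθ : θ ∈ Params.region Sstar (n e)) :
    θ.2 ∈ hM.regularSet := by
  refine ⟨hθ, fun i u => ?_, fun i d u hu => ?_⟩
  · exact ((memLp_congr_ae (h.node_ae_eq_solution hM i u)).1 (h.memLp_node i u)).integrable_sq
  · have hξ := hM.memLp_stdNoise i d
    have hN := h.memLp_node i u
    have h1 : ∫ ω, M.noise θ.2.2 i d ω * (Z e).node i u ω ∂P =
        (∫ ω, M.noise θ.2.2 i d ω ∂P) * ∫ ω, (Z e).node i u ω ∂P :=
      (h.generates_e.noise_indep i d u hu).integral_fun_mul_eq_mul_integral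
        (((hM.measurable_stdNoise i d).const_mul _).const_add _).aestronglyMeasurable
        hN.aestronglyMeasurable
    have i1 : Integrable (fun ω => √(θ.2.2 i d) * M.stdNoise i d ω) P :=
      (hξ.integrable one_le_two).const_mul _
    have h2 : ∫ ω, M.noise θ.2.2 i d ω ∂P = M.mean i d := by
      simp only [Mechanism.noise]
      rw [integral_add (integrable_const _) i1, integral_const_mul, hM.stdNoise_mean]
      simp
    have h3 : ∫ ω, M.noise θ.2.2 i d ω * (Z e).node i u ω ∂P =
        M.mean i d * (∫ ω, (Z e).node i u ω ∂P) +
          √(θ.2.2 i d) * ∫ ω, M.stdNoise i d ω * (Z e).node i u ω ∂P := by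
      rw [← integral_const_mul, ← integral_const_mul, ← integral_add
        ((hN.integrable one_le_two).const_mul _)
        ((integrable_mul_of_memLp_two hξ hN).const_mul _)]
      refine integral_congr_ae (Filter.Eventually.of_forall fun ω => ?_)
      simp only [Mechanism.noise]
      ring
    rw [h1, h2] at h3
    have h4 : √(θ.2.2 i d) * ∫ ω, M.stdNoise i d ω * (Z e).node i u ω ∂P = 0 := by linarith
    have h5 := (mul_eq_zero.1 h4).resolve_left (Real.sqrt_pos.2 (hθ i d)).ne'
    rw [← h5]
    refine integral_congr_ae ?_
    filter_upwards [h.node_ae_eq_solution hM i u] with ω hω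
    rw [hω]

theorem FollowsModel.moment_eq (hM : M.IsAdmissible P Sstar)
    (h : FollowsModel P Sstar F e v M V θ β Z) (u w : Option (Fin D)) :
    hM.moment θ.2.1 θ.2.2 u w =
      obsInner P (fun i => (Z e).node i u) (fun i => (Z e).node i w) := by
  refine integral_congr_ae ?_
  filter_upwards [ae_all_iff.2 fun i => h.node_ae_eq_solution hM i u,
    ae_all_iff.2 fun i => h.node_ae_eq_solution hM i w] with ω h1 h2
  simp only [h1, h2]

/-- The residual variance as a ratio of minors, multiplied out so that it also holds for a singular
Gram matrix. -/
theorem FollowsModel.principalMinor_insert (hM : M.IsAdmissible P Sstar)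
    (h : FollowsModel P Sstar F e v M V θ β Z) (S : Finset (Fin D)) :
    principalMinor (insert none (S.map Function.Embedding.some)) (hM.moment θ.2.1 θ.2.2) =
      principalMinor (S.map Function.Embedding.some) (hM.moment θ.2.1 θ.2.2) *
        obsInner P ((Z e).residual P S) ((Z e).residual P S) := by
  set c : Option (Fin D) → ℝ := fun u =>
    u.elim 0 fun d => if hd : d ∈ S then (Z e).regCoef P S ⟨d, hd⟩ else 0 with hc
  have hsum : ∀ u, ∑ w ∈ S.map Function.Embedding.some, hM.moment θ.2.1 θ.2.2 u w * c w =
      ∑ d : S, hM.moment θ.2.1 θ.2.2 u (some d.1) * (Z e).regCoef P S d := by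
    intro u
    rw [Finset.sum_map, ← Finset.sum_coe_sort]
    refine Finset.sum_congr rfl fun d _ => ?_
    simp [hc]
  rw [principalMinor_insert_of_normal (by simp) c, hsum,
    EnvData.obsInner_residual_self (h.memLp_X e) (h.memLp_Y e)]
  · simp only [h.moment_eq hM]
    rfl
  · intro u hu
    obtain ⟨d, hd, rfl⟩ := Finset.mem_map.1 hu
    rw [hsum]
    have h1 := congrFun (EnvData.gram_mulVec_regCoef (S := S) (h.memLp_X e) (h.memLp_Y e)) ⟨d, hd⟩
    simp only [h.moment_eq hM]
    exact h1

/-- Under the null hypothesis the total residual variance of each environment is proportional to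
its number of observations. -/
theorem NullHypothesis.obsInner_residual {S : Finset (Fin D)} (hS : NullHypothesis P Z S)
    (hX : ∀ a i d, MemLp ((Z a).X i d) 2 P) (hY : ∀ a i, MemLp ((Z a).Y i) 2 P) :
    ∃ q : ℝ, ∀ a, obsInner P ((Z a).residual P S) ((Z a).residual P S) = n a * q := by
  obtain ⟨F', -, hF'⟩ := hS
  refine ⟨∫ x, x * x ∂F', fun a => ?_⟩
  have hR := fun i => EnvData.memLp_residual (S := S) (hX a) (hY a) i
  have h1 : ∀ i, ∫ ω, (Z a).residual P S i ω * (Z a).residual P S i ω ∂P = ∫ x, x * x ∂F' :=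
    fun i => (hF' a i).integral_comp (f := fun x => x * x) (by fun_prop)
  rw [obsInner, integral_finsetSum _ fun i _ => integrable_mul_of_memLp_two (hR i) (hR i)]
  simp [h1]

/-- The noise is centred and independent of the covariates in `Sstar`, so β solves the normal
equations. It differs from `regCoef` by a kernel vector of the Gram matrix, hence gives the same fit
almost surely, and the residual is the noise. -/
theorem FollowsModel.nullHypothesis_parents [IsProbabilityMeasure P]
    (h : FollowsModel P Sstar F e v M V θ β Z) : NullHypothesis P Z Sstar := by
  refine ⟨F, h.linear.isProbabilityMeasure, fun a i => ?_⟩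
  have hX := h.memLp_X a
  have hY := h.memLp_Y a
  have hfit : ∀ i ω, ∑ d, (Z a).X i d ω * β a d = ∑ d : Sstar, (Z a).X i d ω * β a d := by
    intro i ω
    rw [Finset.sum_coe_sort Sstar fun d => (Z a).X i d ω * β a d]
    exact (Finset.sum_subset (Finset.subset_univ _) fun d _ hd => by
      rw [h.linear.coef_eq_zero a d hd, mul_zero]).symm
  have hε : ∀ i, MemLp ((Z a).targetNoise (β a) i) 2 P := by
    intro i
    have : (Z a).targetNoise (β a) i =
        fun ω => (Z a).Y i ω - ∑ d : Sstar, (Z a).X i d ω * β a d :=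
      funext fun ω => by rw [EnvData.targetNoise, hfit]
    rw [this]
    exact (hY i).sub (memLp_fit hX (fun d : Sstar => β a d) i)
  have hε0 : ∀ i, ∫ ω, (Z a).targetNoise (β a) i ω ∂P = 0 := fun i =>
    ((h.linear.noise_law a i).integral_comp (f := fun x => x) (by fun_prop)).trans
      h.linear.mean_zero
  have horth : ∀ c : Sstar,
      obsInner P (fun i => (Z a).X i c) ((Z a).targetNoise (β a)) = 0 := by
    intro c
    rw [obsInner, integral_finsetSum _ fun i _ => integrable_mul_of_memLp_two (hX i c) (hε i)]
    refine Finset.sum_eq_zero fun i _ => ?_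
    have hind : IndepFun ((Z a).X i c) ((Z a).targetNoise (β a) i) P :=
      ((h.linear.noise_indep_parents a i).comp (φ := id)
        (ψ := fun x : Sstar → ℝ => x c) measurable_id (measurable_pi_apply c)).symm
    rw [hind.integral_fun_mul_eq_mul_integral (hX i c).aestronglyMeasurable
      (hε i).aestronglyMeasurable, hε0, mul_zero]
  have hcross : ((Z a).gram P Sstar).mulVec (fun d : Sstar => β a d) = (Z a).cross P Sstar := by
    funext c
    have h1 : obsInner P (fun i => (Z a).X i c) ((Z a).targetNoise (β a)) =
        obsInner P (fun i => (Z a).X i c) (fun i ω => (Z a).Y i ω -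
          ∑ d : Sstar, (Z a).X i d ω * β a d) := by
      congr 1
      funext i ω
      rw [EnvData.targetNoise, hfit]
    rw [horth c, obsInner_sub_right (fun i => hX i c) hY
      (memLp_fit hX (fun d : Sstar => β a d)), obsInner_fit_right hX fun i => hX i c] at h1
    exact (sub_eq_zero.1 h1.symm).symm
  have hker : ((Z a).gram P Sstar).mulVec
      ((Z a).regCoef P Sstar - fun d : Sstar => β a d) = 0 := by
    rw [Matrix.mulVec_sub, EnvData.gram_mulVec_regCoef hX hY, hcross, sub_self]
  refine (h.linear.noise_law a i).congr ?_
  filter_upwards [EnvData.ae_fit_eq_zero hX hker i] with ω hω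
  rw [EnvData.residual, EnvData.targetNoise, hfit]
  simp only [Pi.sub_apply, mul_sub, Finset.sum_sub_distrib] at hω
  linarith

/-- For almost all parameters the residual variances given `S` differ between the environments `e`
and `v`, unless `S` contains `Sstar`. -/
theorem exists_null_set_of_not_subset [IsProbabilityMeasure P] (hn : ∀ a, 0 < n a)
    (hM : M.IsAdmissible P Sstar) (hV : MeasurableFamily V) {S : Finset (Fin D)}
    (hS : ¬ Sstar ⊆ S) :
    ∃ M₀ : Set (Params Sstar (n e)), M₀ ⊆ Params.region Sstar (n e) ∧ volume M₀ = 0 ∧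
      ∀ θ ∈ Params.region Sstar (n e) \ M₀,
        ∀ (β : Fin E → Fin D → ℝ) (Z : (a : Fin E) → EnvData Ω D (n a)),
          FollowsModel P Sstar F e v M V θ β Z → ¬ NullHypothesis P Z S := by
  obtain ⟨d, hd, hdS⟩ := Finset.not_subset.1 hS
  set T := S.map Function.Embedding.some with hT
  have hTn : none ∉ T := by simp [hT]
  have hTd : some d ∉ T := by simp [hT, hdS]
  -- The relation n^v R^e = n^e R^v, multiplied by the minor on `T`, with R^v written as the
  -- measurable `minRisk`.
  set A : Set (Params Sstar (n e)) := {θ | θ.2 ∈ hM.regularSet ∧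
    n v * principalMinor (insert none T) (hM.moment θ.2.1 θ.2.2) =
      n e * ((V θ.1 θ.2.2).minRisk P S).toReal *
        principalMinor T (hM.moment θ.2.1 θ.2.2)} with hA
  have hv0 : (n v : ℝ) ≠ 0 := by exact_mod_cast (hn v).ne'
  have hA_meas : MeasurableSet A := by
    have h1 := fun T => (hM.measurable_principalMinor_moment T).comp
      (measurable_snd : Measurable fun θ : Params Sstar (n e) => θ.2)
    have h2 := (measurable_minRisk (P := P) hV S).comp
      (measurable_params_fst_snd (Sstar := Sstar) (N := n e))
    exact (measurable_snd hM.measurableSet_regularSet).inter (measurableSet_eq_fun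
      ((h1 _).const_mul _) ((h2.ennreal_toReal.const_mul _).mul (h1 _)))
  have hnull : volume A = 0 := by
    refine (Measure.measure_prod_null hA_meas).2 (Filter.Eventually.of_forall fun x => ?_)
    refine measure_prod_eq_zero_of_fibre_square (hA_meas.preimage measurable_prodMk_left) ?_
    -- With β^v fixed at `x`, the first slot of `Params` is reused for a second copy `b'` of β^e.
    -- Both copies share `minRisk`, which cancels on cross-multiplying.
    refine measure_mono_null ?_
      (hM.measure_principalMinor_insert_eq (hn e) ⟨d, hd⟩ T hTn hTd)
    rintro ⟨b', b, Δ⟩ ⟨⟨hr', h'⟩, hr, h⟩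
    refine ⟨hr', hr, mul_left_cancel₀ hv0 ?_⟩
    simp only at h h' ⊢
    linear_combination principalMinor T (hM.moment b Δ) * h' -
      principalMinor T (hM.moment b' Δ) * h
  refine ⟨A ∩ Params.region Sstar (n e), Set.inter_subset_right,
    measure_mono_null Set.inter_subset_left hnull, ?_⟩
  rintro θ ⟨hθ, hθ'⟩ β Z h hH
  refine hθ' ⟨⟨h.mem_regularSet hM hθ, ?_⟩, hθ⟩
  obtain ⟨q, hq⟩ := hH.obsInner_residual h.memLp_X h.memLp_Y
  rw [h.principalMinor_insert hM S, ← h.data_v,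
    EnvData.minRisk_eq (h.memLp_X v) (h.memLp_Y v),
    ENNReal.toReal_ofReal (obsInner_self_nonneg _), hq, hq]
  ring

end Model

/-! ### The identification theorem. -/

theorem theorem1 {Ω : Type*} [MeasurableSpace Ω] (P : Measure Ω) [IsProbabilityMeasure P]
    {E D : ℕ} (n : Fin E → ℕ) (hn : ∀ a, 0 < n a)
    (Sstar : Finset (Fin D)) (F : Measure ℝ)
    (e v : Fin E) (hev : e ≠ v)
    (M : Mechanism Ω D (n e)) (hM : M.IsAdmissible P Sstar)
    (V : (Sstar → ℝ) → (Fin (n e) → Fin D → ℝ) → EnvData Ω D (n v))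
    (hV : MeasurableFamily V) :
    (∀ S : Finset (Fin D), ¬ Sstar ⊆ S →
      ∃ M₀ : Set (Params Sstar (n e)), M₀ ⊆ Params.region Sstar (n e) ∧ volume M₀ = 0 ∧
        ∀ θ ∈ Params.region Sstar (n e) \ M₀,
          ∀ (β : Fin E → Fin D → ℝ) (Z : (a : Fin E) → EnvData Ω D (n a)),
            FollowsModel P Sstar F e v M V θ β Z → ¬ NullHypothesis P Z S) ∧
    (∃ M₁ : Set (Params Sstar (n e)), M₁ ⊆ Params.region Sstar (n e) ∧ volume M₁ = 0 ∧
      ∀ θ ∈ Params.region Sstar (n e) \ M₁,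
        ∀ (β : Fin E → Fin D → ℝ) (Z : (a : Fin E) → EnvData Ω D (n a)),
          FollowsModel P Sstar F e v M V θ β Z →
            ∀ d, d ∈ Sstar ↔ ∀ S : Finset (Fin D), NullHypothesis P Z S → d ∈ S) := by
  have hpart : ∀ S : Finset (Fin D), ¬ Sstar ⊆ S → _ := fun S hS =>
    exists_null_set_of_not_subset (F := F) hn hM hV hS
  refine ⟨hpart, ?_⟩
  choose! M₀ hsub hnull hM₀ using hpart
  refine ⟨⋃ S ∈ {S : Finset (Fin D) | ¬ Sstar ⊆ S}, M₀ S, Set.iUnion₂_subset hsub,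
    (measure_biUnion_null_iff (Set.to_countable _)).2 hnull, ?_⟩
  rintro θ ⟨hθ, hθ'⟩ β Z h d
  refine ⟨fun hd S hS => ?_, fun hd => hd Sstar h.nullHypothesis_parents⟩
  by_contra hdS
  have hSS : ¬ Sstar ⊆ S := fun hh => hdS (hh hd)
  exact hM₀ S hSS θ ⟨hθ, fun hh => hθ' (Set.mem_iUnion₂.2 ⟨S, hSS, hh⟩)⟩ β Z h hS
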